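/- Let $\mathbb{K}$ be an algebraically closed field and let $\Lambda$ be a basic finite-dimensional $\mathbb{K}$-algebra, presented as $\Lambda\cong \mathbb{K}Q/I$ with $Q$ a finite quiver and $I$ an admissible ideal of the path algebra $\mathbb{K}Q$. Let $\Lambda\text{-mod}$ be the category of finite-dimensional left $\Lambda$-modules. For $\mathbf{d}\in\mathbb{N}_0^{Q_0}$ let $\mathrm{R}_{\mathbf{d}}(\Lambda)\subseteq \bigoplus_{(\alpha\colon i\to j)\in Q_1}\mathbb{K}^{d_j\times d_i}$ be the closed subset of the representations of $Q$ of dimension vector $\mathbf{d}$ that satisfy the relations in $I$. A full subcategory $\mathcal{X}\subseteq\Lambda\text{-mod}$ is called additively closed if it is closed under direct summands of finite direct sums; in particular it contains $0$ and is closed under isomorphism. An additively closed subcategory $\mathcal{X}$ is called open if for every $\mathbf{d}\in\mathbb{N}_0^{Q_0}$ the set $\{M\in \mathrm{R}_{\mathbf{d}}(\Lambda) : M\in\mathcal{X}\}$ is open in $\mathrm{R}_{\mathbf{d}}(\Lambda)$ in the Zariski topology. For subcategories $\mathcal{X}_1,\ldots,\mathcal{X}_r$ of $\Lambda\text{-mod}$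 let $\mathrm{Filt}(\mathcal{X}_1,\ldots,\mathcal{X}_r)$ be the full subcategory of the modules $X$ that possess a chain of submodules $0=F_0\subseteq F_1\subseteq\cdots\subseteq F_n=X$, for some $n\in\mathbb{N}_0$, such that each $F_k/F_{k-1}$ with $1\le k\le n$ belongs to $\mathcal{X}_1\cup\cdots\cup\mathcal{X}_r$. For a full subcategory $\mathcal{Y}$ let $\mathrm{add}(\mathcal{Y})$ be its closure under direct summands of finite direct sums. Proposition. Let $\mathcal{X}_1,\ldots,\mathcal{X}_r$ be open subcategories of $\Lambda\text{-mod}$ such that $\mathrm{Ext}^1_\Lambda(X_j,X_i)=0$ for all $1\le i<j\le r$ and all $X_i\in\mathcal{X}_i$, $X_j\in\mathcal{X}_j$. Then $\mathrm{add}(\mathrm{Filt}(\mathcal{X}_1,\ldots,\mathcal{X}_r))$ is again an open subcategory of $\Lambda\text{-mod}$. -/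

import Mathlib

universe u

set_option linter.unusedSectionVars false

namespace BoundQuiver

open CategoryTheory

/-- A path of the quiver `Q`, together with its source and its target. -/
structure QPath (Q : Type) [Quiver.{0} Q] where
  /-- the source of the path -/
  src : Q
  /-- the target of the path -/
  tgt : Q
  /-- the path itself -/
  path : Quiver.Path src tgt

/-- The path algebra `K Q` of the quiver `Q`: the `K`-vector space with basis the paths of `Q`
(the multiplication is defined below). -/
def PathAlgebra (K : Type u) (Q : Type) [Field K] [Quiver.{0} Q] : Type u :=
  QPath Q →₀ K

namespace PathAlgebra

variable {K : Type u} {Q : Type} [Field K] [Quiver.{0} Q]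

noncomputable instance : AddCommGroup (PathAlgebra K Q) :=
  inferInstanceAs (AddCommGroup (QPath Q →₀ K))

noncomputable instance : Module K (PathAlgebra K Q) :=
  inferInstanceAs (Module K (QPath Q →₀ K))

/-- The basis element of the path algebra given by a path. -/
noncomputable def ofPath (K : Type u) [Field K] (p : QPath Q) : PathAlgebra K Q :=
  Finsupp.single p 1

/-- The linear map out of the path algebra with prescribed values on the paths. -/
noncomputable def lift {V : Type*} [AddCommGroup V] [Module K V] (f : QPath Q → V) :
    PathAlgebra K Q →ₗ[K] V :=
  Finsupp.linearCombination K f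

@[simp]
theorem lift_ofPath {V : Type*} [AddCommGroup V] [Module K V] (f : QPath Q → V) (p : QPath Q) :
    lift f (ofPath K p) = f p := by
  unfold lift ofPath
  exact (Finsupp.linearCombination_single K 1 p).trans (one_smul K _)

theorem hom_ext {V : Type*} [AddCommGroup V] [Module K V] {f g : PathAlgebra K Q →ₗ[K] V}
    (h : ∀ p, f (ofPath K p) = g (ofPath K p)) : f = g :=
  Finsupp.lhom_ext' fun p => LinearMap.ext_ring (h p)

variable [DecidableEq Q]

/-- The product `p * q` of two paths: first `q`, then `p` if `p` starts where `q` ends,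
and `0` otherwise. -/
noncomputable def pathMul (K : Type u) [Field K] (p q : QPath Q) : PathAlgebra K Q :=
  if h : q.tgt = p.src then ofPath K ⟨q.src, p.tgt, (q.path.cast rfl h).comp p.path⟩ else 0

/-- The multiplication of the path algebra as a bilinear map. -/
noncomputable def mulₗ : PathAlgebra K Q →ₗ[K] PathAlgebra K Q →ₗ[K] PathAlgebra K Q :=
  lift fun p => lift fun q => pathMul K p q

noncomputable instance : Mul (PathAlgebra K Q) := ⟨fun x y => mulₗ x y⟩

theorem mul_def (x y : PathAlgebra K Q) : x * y = mulₗ x y := rfl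

theorem ofPath_mul_ofPath (p q : QPath Q) : ofPath K p * ofPath K q = pathMul K p q := by
  simp [mul_def, mulₗ]

theorem pathMul_of_eq {i j k : Q} (q : Quiver.Path i j) (p : Quiver.Path j k) :
    pathMul K ⟨j, k, p⟩ ⟨i, j, q⟩ = ofPath K ⟨i, k, q.comp p⟩ := by
  simp [pathMul]

theorem pathMul_of_ne {p q : QPath Q} (h : q.tgt ≠ p.src) : pathMul K p q = 0 := by
  simp [pathMul, h]

theorem mulₗ_assoc (x y z : PathAlgebra K Q) : mulₗ (mulₗ x y) z = mulₗ x (mulₗ y z) := by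
  have h : ∀ p q r : QPath Q, mulₗ (mulₗ (ofPath K p) (ofPath K q)) (ofPath K r) =
      mulₗ (ofPath K p) (mulₗ (ofPath K q) (ofPath K r)) := by
    rintro ⟨k, l, p⟩ ⟨j, k', q⟩ ⟨i, j', r⟩
    simp only [← mul_def, ofPath_mul_ofPath]
    by_cases h1 : k' = k
    · subst h1
      by_cases h2 : j' = j
      · subst h2
        simp only [pathMul_of_eq, ofPath_mul_ofPath, Quiver.Path.comp_assoc]
      · rw [pathMul_of_eq, ofPath_mul_ofPath, pathMul_of_ne (by exact h2),
          pathMul_of_ne (by exact h2), mul_def, map_zero]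
    · rw [pathMul_of_ne (by exact h1), mul_def, map_zero, LinearMap.zero_apply]
      by_cases h2 : j' = j
      · subst h2
        rw [pathMul_of_eq, ofPath_mul_ofPath, pathMul_of_ne (by exact h1)]
      · rw [pathMul_of_ne (by exact h2), mul_def, map_zero]
  have h1 : ∀ p q : QPath Q, mulₗ (mulₗ (ofPath K p) (ofPath K q)) =
      mulₗ (ofPath K p) ∘ₗ mulₗ (ofPath K q) := fun p q => hom_ext (h p q)
  have h2 : ∀ p : QPath Q, mulₗ ∘ₗ mulₗ (ofPath K p) =
      (LinearMap.llcomp K _ _ _ (mulₗ (ofPath K p))) ∘ₗ mulₗ := fun p => hom_ext (h1 p)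
  have h3 : (LinearMap.llcomp K _ _ _ mulₗ) ∘ₗ mulₗ =
      (LinearMap.lcomp K _ (mulₗ (K := K) (Q := Q))) ∘ₗ (LinearMap.llcomp K _ _ _) ∘ₗ mulₗ :=
    hom_ext h2
  exact LinearMap.congr_fun (LinearMap.congr_fun (LinearMap.congr_fun h3 x) y) z

variable [Fintype Q]

/-- The unit of the path algebra is the sum of the trivial paths. -/
noncomputable instance : One (PathAlgebra K Q) :=
  ⟨∑ i : Q, ofPath K ⟨i, i, Quiver.Path.nil⟩⟩

theorem one_def : (1 : PathAlgebra K Q) = ∑ i : Q, ofPath K ⟨i, i, Quiver.Path.nil⟩ := rfl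

theorem mulₗ_one_left : mulₗ (1 : PathAlgebra K Q) = LinearMap.id := by
  refine hom_ext fun p => ?_
  obtain ⟨i, j, p⟩ := p
  rw [one_def, map_sum, LinearMap.sum_apply, LinearMap.id_apply, Finset.sum_eq_single j]
  · rw [← mul_def, ofPath_mul_ofPath, pathMul_of_eq, Quiver.Path.comp_nil]
  · intro k _ hk
    rw [← mul_def, ofPath_mul_ofPath, pathMul_of_ne (by exact hk.symm)]
  · simp

theorem mulₗ_one_right : mulₗ.flip (1 : PathAlgebra K Q) = LinearMap.id := by
  refine hom_ext fun p => ?_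
  obtain ⟨i, j, p⟩ := p
  rw [LinearMap.flip_apply, one_def, map_sum, LinearMap.id_apply, Finset.sum_eq_single i]
  · rw [← mul_def, ofPath_mul_ofPath, pathMul_of_eq, Quiver.Path.nil_comp]
  · intro k _ hk
    rw [← mul_def, ofPath_mul_ofPath, pathMul_of_ne (by exact hk)]
  · simp

noncomputable instance : Ring (PathAlgebra K Q) :=
  { (inferInstance : AddCommGroup (PathAlgebra K Q)),
    (inferInstance : Mul (PathAlgebra K Q)),
    (inferInstance : One (PathAlgebra K Q)) with
    left_distrib := fun x y z => map_add (mulₗ x) y z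
    right_distrib := fun x y z => LinearMap.congr_fun (map_add mulₗ x y) z
    zero_mul := fun x => LinearMap.congr_fun (map_zero mulₗ) x
    mul_zero := fun x => map_zero (mulₗ x)
    mul_assoc := mulₗ_assoc
    one_mul := fun x => LinearMap.congr_fun mulₗ_one_left x
    mul_one := fun x => LinearMap.congr_fun mulₗ_one_right x }

noncomputable instance : Algebra K (PathAlgebra K Q) :=
  Algebra.ofModule (fun r x y => LinearMap.congr_fun (map_smul mulₗ r x) y)
    (fun r x y => map_smul (mulₗ x) r y)

/-- The `m`-th power of the arrow ideal: the span of all paths of length at least `m`. -/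
noncomputable def arrowIdealPow (K : Type u) (Q : Type) [Field K] [Quiver.{0} Q] (m : ℕ) :
    Submodule K (PathAlgebra K Q) :=
  Submodule.span K {x | ∃ p : QPath Q, m ≤ p.path.length ∧ x = ofPath K p}

end PathAlgebra

variable (K : Type u) [Field K] (Q : Type) [Quiver.{0} Q] [Fintype Q] [DecidableEq Q]
  (Λ : Type u) [Ring Λ] [Algebra K Λ]

/-- A presentation `Λ ≅ K Q / I` of the algebra `Λ` by the quiver `Q` and an admissible ideal `I`:
a surjection from the path algebra whose kernel `I` satisfies `R ^ m ⊆ I ⊆ R ^ 2` for some `m ≥ 2`,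
where `R` is the arrow ideal. -/
structure Presentation where
  /-- the projection from the path algebra -/
  proj : PathAlgebra K Q →ₐ[K] Λ
  surjective : Function.Surjective proj
  admissible : ∃ m : ℕ, 2 ≤ m ∧
    PathAlgebra.arrowIdealPow K Q m ≤ LinearMap.ker proj.toLinearMap ∧
    LinearMap.ker proj.toLinearMap ≤ PathAlgebra.arrowIdealPow K Q 2

section Representations

variable {Q}

/-- An arrow of the quiver, together with its source and its target. -/
structure Arrow (Q : Type) [Quiver.{0} Q] where
  /-- the source of the arrow -/
  src : Q
  /-- the target of the arrow -/
  tgt : Q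
  /-- the arrow itself -/
  hom : src ⟶ tgt

/-- The space `R_d(Q)` of representations of `Q` of dimension vector `d`: an arrow `i ⟶ j` is
assigned a matrix of size `d j × d i`. -/
abbrev Rep (d : Q → ℕ) : Type u :=
  ∀ a : Arrow Q, Matrix (Fin (d a.tgt)) (Fin (d a.src)) K

/-- The index set of the coordinates (matrix entries) of the affine space `R_d(Q)`. -/
abbrev Coord (d : Q → ℕ) : Type :=
  Σ a : Arrow Q, Fin (d a.tgt) × Fin (d a.src)

/-- The total space `⨁ i, K ^ (d i)` of a representation of dimension vector `d`. -/
abbrev TotalSpace (d : Q → ℕ) : Type u :=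
  ∀ i : Q, Fin (d i) → K

variable {K} {d : Q → ℕ}

/-- The matrix entries of a representation. -/
def Rep.coords (M : Rep K d) : Coord d → K :=
  fun c => M c.1 c.2.1 c.2.2

/-- The matrix by which a path acts in a representation. -/
def Rep.pathMatrix (M : Rep K d) {i : Q} :
    ∀ {j : Q}, Quiver.Path i j → Matrix (Fin (d j)) (Fin (d i)) K
  | _, Quiver.Path.nil => 1
  | _, Quiver.Path.cons p a => M ⟨_, _, a⟩ * M.pathMatrix p

theorem Rep.pathMatrix_comp (M : Rep K d) {i j k : Q} (p : Quiver.Path i j) (q : Quiver.Path j k) :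
    M.pathMatrix (p.comp q) = M.pathMatrix q * M.pathMatrix p := by
  induction q with
  | nil => simp [Rep.pathMatrix]
  | cons q a ih => simp [Rep.pathMatrix, ih, Matrix.mul_assoc]

/-- The endomorphism of the total space by which a path acts in a representation. -/
noncomputable def Rep.pathEnd (M : Rep K d) (p : QPath Q) : Module.End K (TotalSpace K d) :=
  LinearMap.single K (fun i : Q => Fin (d i) → K) p.tgt ∘ₗ
    (M.pathMatrix p.path).mulVecLin ∘ₗ LinearMap.proj p.src

theorem Rep.pathEnd_apply (M : Rep K d) (p : QPath Q) (v : TotalSpace K d) :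
    M.pathEnd p v = Pi.single p.tgt ((M.pathMatrix p.path).mulVec (v p.src)) := rfl

theorem Rep.lift_pathMul (M : Rep K d) (p q : QPath Q) :
    PathAlgebra.lift M.pathEnd (PathAlgebra.pathMul K p q) = M.pathEnd p * M.pathEnd q := by
  obtain ⟨k, l, p⟩ := p
  obtain ⟨i, j, q⟩ := q
  refine LinearMap.ext fun v => ?_
  rw [Module.End.mul_apply, Rep.pathEnd_apply, Rep.pathEnd_apply]
  by_cases h : j = k
  · subst h
    rw [PathAlgebra.pathMul_of_eq, PathAlgebra.lift_ofPath, Rep.pathEnd_apply]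
    simp [Rep.pathMatrix_comp]
  · rw [PathAlgebra.pathMul_of_ne (by exact h), map_zero]
    simp [Pi.single_eq_of_ne (Ne.symm h)]

/-- The action of the path algebra on the total space of a representation. -/
noncomputable def Rep.action (M : Rep K d) :
    PathAlgebra K Q →ₐ[K] Module.End K (TotalSpace K d) :=
  AlgHom.ofLinearMap (PathAlgebra.lift M.pathEnd)
    (by
      refine LinearMap.ext fun v => ?_
      rw [PathAlgebra.one_def, map_sum, LinearMap.sum_apply]
      simp only [PathAlgebra.lift_ofPath, Rep.pathEnd_apply, Rep.pathMatrix, Matrix.one_mulVec]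
      exact Finset.univ_sum_single v)
    (by
      have h : ∀ p, PathAlgebra.lift M.pathEnd ∘ₗ PathAlgebra.mulₗ (PathAlgebra.ofPath K p) =
          LinearMap.mul K _ (M.pathEnd p) ∘ₗ PathAlgebra.lift M.pathEnd := fun p =>
        PathAlgebra.hom_ext fun q => by
          rw [LinearMap.comp_apply, ← PathAlgebra.mul_def, PathAlgebra.ofPath_mul_ofPath,
            Rep.lift_pathMul]
          simp
      have h2 : ∀ y, PathAlgebra.lift M.pathEnd ∘ₗ PathAlgebra.mulₗ.flip y =
          LinearMap.mulRight K (PathAlgebra.lift M.pathEnd y) ∘ₗ PathAlgebra.lift M.pathEnd :=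
        fun y => PathAlgebra.hom_ext fun p => by
          simpa using LinearMap.congr_fun (h p) y
      exact fun x y => LinearMap.congr_fun (h2 y) x)

variable {Λ}

/-- The closed subset `R_d(Λ)` of `R_d(Q)`, consisting of the representations which satisfy all the relations
in the ideal `I` of the presentation `Λ ≅ K Q / I`. -/
def repVariety (P : Presentation K Q Λ) (d : Q → ℕ) : Set (Rep K d) :=
  {M | ∀ x : PathAlgebra K Q, P.proj x = 0 → M.action x = 0}

/-- The action of `Λ` on the total space of a representation in `R_d(Λ)`. It is characterized by
`repAction P M hM (P.proj x) = M.action x`. -/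
noncomputable def repAction (P : Presentation K Q Λ) (M : Rep K d) (hM : M ∈ repVariety P d) :
    Λ →+* Module.End K (TotalSpace K d) :=
  RingHom.liftOfSurjective P.proj.toRingHom P.surjective
    ⟨M.action.toRingHom, fun x hx => hM x hx⟩

theorem repAction_proj (P : Presentation K Q Λ) (M : Rep K d) (hM : M ∈ repVariety P d)
    (x : PathAlgebra K Q) : repAction P M hM (P.proj x) = M.action x :=
  RingHom.liftOfRightInverse_comp_apply P.proj.toRingHom _
    (Function.rightInverse_surjInv P.surjective) ⟨M.action.toRingHom, fun x hx => hM x hx⟩ x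

/-- A point of `R_d(Λ)`, regarded as a left `Λ`-module. -/
noncomputable def repModule (P : Presentation K Q Λ) (M : Rep K d) (hM : M ∈ repVariety P d) :
    ModuleCat.{u} Λ :=
  letI : Module Λ (TotalSpace K d) := Module.compHom _ (repAction P M hM)
  ModuleCat.of Λ (TotalSpace K d)

/-- `U ⊆ Z` is open in the Zariski topology of the subset `Z` of the affine space `R_d(Q)`: it is
the complement in `Z` of the common zero locus of a set of polynomials in the coordinates. -/
def IsZariskiOpenIn (Z U : Set (Rep K d)) : Prop :=
  U ⊆ Z ∧ ∃ S : Set (MvPolynomial (Coord d) K),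
    ∀ M ∈ Z, M ∈ U ↔ ∃ f ∈ S, MvPolynomial.eval M.coords f ≠ 0

/-- The subset `R_d(𝒳)` of `R_d(Λ)` of the representations which belong to `𝒳`. -/
def repLocus (P : Presentation K Q Λ) (X : ObjectProperty (ModuleCat.{u} Λ)) (d : Q → ℕ) :
    Set (Rep K d) :=
  {M | ∃ hM : M ∈ repVariety P d, X (repModule P M hM)}

end Representations

section Subcategories

variable {K Q Λ}

/-- `add(𝒴)`: the closure of the full subcategory `𝒴` under direct summands of finite direct
sums. -/
def addClosure (Y : ObjectProperty (ModuleCat.{u} Λ)) : ObjectProperty (ModuleCat.{u} Λ) :=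
  fun M => ∃ (n : ℕ) (A : Fin n → ModuleCat.{u} Λ) (N : ModuleCat.{u} Λ),
    (∀ i, Y (A i)) ∧ Nonempty ((M × N) ≃ₗ[Λ] (∀ i, A i))

/-- `Filt(𝒳)`: the modules `M` with a chain of submodules `0 = F 0 ⊆ F 1 ⊆ ⋯ ⊆ F n = M`, for some
`n ≥ 0`, all of whose subquotients `F (i + 1) / F i` belong to `𝒳`. -/
def Filt (X : ObjectProperty (ModuleCat.{u} Λ)) : ObjectProperty (ModuleCat.{u} Λ) :=
  fun M => ∃ (n : ℕ) (F : Fin (n + 1) → Submodule Λ M),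
    Monotone F ∧ F 0 = ⊥ ∧ F (Fin.last n) = ⊤ ∧
      ∀ i : Fin n, X (ModuleCat.of Λ (F i.succ ⧸ (F i.castSucc).submoduleOf (F i.succ)))

/-- A full subcategory of the category `Λ`-mod of finite-dimensional (equivalently, finitely
generated) modules over the finite-dimensional algebra `Λ` is additively closed if it is closed
under direct summands of finite direct sums. In particular it contains the zero module and is
closed under isomorphisms. -/
structure IsAdditivelyClosed (X : ObjectProperty (ModuleCat.{u} Λ)) : Prop where
  finite : ∀ M, X M → Module.Finite Λ M
  addClosure_le : addClosure X ≤ X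

/-- Open subcategories of `Λ`-mod: the additively closed full subcategories `𝒳` for which
`R_d(𝒳)` is Zariski open in `R_d(Λ)` for all dimension vectors `d`. -/
structure IsOpenSubcategory (P : Presentation K Q Λ) (X : ObjectProperty (ModuleCat.{u} Λ)) :
    Prop where
  isAdditivelyClosed : IsAdditivelyClosed X
  isOpen : ∀ d : Q → ℕ, IsZariskiOpenIn (repVariety P d) (repLocus P X d)

end Subcategories

end BoundQuiver

/-! ### Lifting closed points along flat and étale maps -/

section PointLifting

/-! Openness is tested on arbitrary algebraic families: a homomorphism `σ : Λ → Mₙ(B)` is a family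
of modules over the `K`-points of `B`, and a property is `LocallyOpen` if it spreads from a point to
a principal open neighbourhood. Properties with Zariski open loci are locally open
(`locallyOpen_of_isZariskiOpenIn`): after a localization the vertex idempotents of a family become
constant, so that the family is pulled back from some `R_d(Λ)`. Conversely, the universal family
over the polynomial functions on `R_d(Λ)` shows that loci of locally open properties are open
(`LocallyOpen.isZariskiOpenIn`).

The geometric core is `LocallyOpen.extensionProperty`. Let `U ⊆ M` with `U` in `X`, `M/U` in `Z` and
`Ext¹(U, M/U) = 0`. The obstruction to deforming `U` along with `M` lies in this group, so `U`
extends to submodules of nearby members after an étale base change. Concretely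
(`exists_graph_lifting`), subspaces near `U` are graphs of matrices `φ`, invariance is a quadratic
matrix equation in `φ`, and its linear part produces the inner derivations. A transversal slice
gives equally many equations and unknowns with invertible Jacobian; a Nakayama argument, using that
all derivations are inner, shows that these equations imply invariance locally. Openness of flat
maps and the Nullstellensatz then lift points.

Algebra does the rest. Each open `X i` is closed under extensions, since an extension degenerates to
the direct sum of its ends (`LocallyOpen.extensionProperty_le`). As `Ext¹` from the last class to
all earlier ones vanishes, factors in the last class can be moved to the bottom of a filtration and
merged there (`filtered_or_eq`), so a filtered module is an extension of a module filtered by the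
earlier classes by one module of the last class. Induction on `r` makes `Filt` locally open. Finally
`Filt` is closed under direct sums, so its additive closure consists of the `M` for which some `M ⊕
N` is filtered, and keeping `N` constant preserves local openness (`LocallyOpen.of_prod`). -/

theorem exists_algHom_ne_zero_of_prime {K B : Type*} [Field K] [IsAlgClosed K] [CommRing B]
    [Algebra K B] [Algebra.FiniteType K B] [IsDomain B] {g : B} (hg : g ≠ 0) :
    ∃ b : B →ₐ[K] K, b g ≠ 0 := by
  have : IsJacobsonRing B := isJacobsonRing_of_finiteType (A := K)
  -- Nullstellensatz: in a Jacobson domain some maximal ideal avoids `g`, and its residue field is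
  -- finite over `K`, hence equal to `K`.
  have h : (⊥ : Ideal B).jacobson = ⊥ :=
    IsJacobsonRing.out' _ (Ideal.IsPrime.isRadical Ideal.isPrime_bot)
  have hg' : g ∉ (⊥ : Ideal B).jacobson := by rw [h]; simpa using hg
  rw [Ideal.jacobson, Ideal.mem_sInf] at hg'
  push Not at hg'
  obtain ⟨M, ⟨-, hM⟩, hgM⟩ := hg'
  let _ : Field (B ⧸ M) := Ideal.Quotient.field M
  have : Module.Finite K (B ⧸ M) := finite_of_finite_type_of_isJacobsonRing K (B ⧸ M)
  have hb := IsAlgClosed.algebraMap_bijective_of_isIntegral (k := K) (K := B ⧸ M)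
  let e : K ≃ₐ[K] (B ⧸ M) := AlgEquiv.ofBijective (Algebra.ofId K (B ⧸ M)) hb
  refine ⟨(e.symm : (B ⧸ M) →ₐ[K] K).comp (Ideal.Quotient.mkₐ K M), fun h0 => hgM ?_⟩
  have : e.symm (Ideal.Quotient.mk M g) = 0 := h0
  rw [EmbeddingLike.map_eq_zero_iff] at this
  exact Ideal.Quotient.eq_zero_iff_mem.1 this

/-- A flat map of finite presentation is open on spectra, so the image of `D(g)` contains a
principal neighbourhood `D(f)` of the image of `b₀`. The fibre over a `K`-point is of finite type
over `K`, even if `A` is not, so nonempty fibres of `D(g)` have `K`-points. -/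
theorem exists_algHom_extension_of_flat {K A B : Type*} [Field K] [IsAlgClosed K] [CommRing A]
    [CommRing B] [Algebra K A] [Algebra K B] [Algebra A B] [IsScalarTower K A B]
    [Algebra.FinitePresentation A B] [Module.Flat A B] (b₀ : B →ₐ[K] K) {g : B} (hg : b₀ g ≠ 0) :
    ∃ f : A, b₀ (algebraMap A B f) ≠ 0 ∧ ∀ a : A →ₐ[K] K, a f ≠ 0 →
      ∃ b : B →ₐ[K] K, (∀ x, b (algebraMap A B x) = a x) ∧ b g ≠ 0 := by
  have hopen := (PrimeSpectrum.isOpenMap_comap_of_hasGoingDown_of_finitePresentation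
    (R := A) (S := B)) _ (PrimeSpectrum.basicOpen g).isOpen
  let q : PrimeSpectrum B := ⟨RingHom.ker b₀, RingHom.ker_isPrime b₀⟩
  have hq : q ∈ PrimeSpectrum.basicOpen g := hg
  obtain ⟨_, ⟨_, ⟨f, rfl⟩, rfl⟩, hf, hfU⟩ := PrimeSpectrum.isBasis_basic_opens.exists_subset_of_mem_open
    (Set.mem_image_of_mem (PrimeSpectrum.comap (algebraMap A B)) hq) hopen
  refine ⟨f, hf, fun a ha => ?_⟩
  let p : PrimeSpectrum A := ⟨RingHom.ker a, RingHom.ker_isPrime a⟩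
  obtain ⟨P, hPg, hP⟩ := hfU (show p ∈ (PrimeSpectrum.basicOpen f : Set _) from ha)
  have hPa : ∀ x, algebraMap A B x ∈ P.asIdeal ↔ a x = 0 := fun x => by
    have : x ∈ (PrimeSpectrum.comap (algebraMap A B) P).asIdeal ↔ x ∈ p.asIdeal := by rw [hP]
    exact this
  have hker : ∀ x, Ideal.Quotient.mk P.asIdeal (algebraMap A B x) =
      algebraMap K (B ⧸ P.asIdeal) (a x) := fun x => by
    have : algebraMap A B (x - algebraMap K A (a x)) ∈ P.asIdeal := by
      rw [hPa]; simp
    rw [map_sub, ← IsScalarTower.algebraMap_apply, ← Ideal.Quotient.eq] at this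
    exact this
  have : Algebra.FiniteType K (B ⧸ P.asIdeal) := by
    obtain ⟨s, hs⟩ := (inferInstance : Algebra.FiniteType A (B ⧸ P.asIdeal))
    refine ⟨s, ?_⟩
    rw [eq_top_iff]
    rintro x -
    have hx : x ∈ Algebra.adjoin A (s : Set (B ⧸ P.asIdeal)) := by rw [hs]; trivial
    induction hx using Algebra.adjoin_induction with
    | mem x hx => exact Algebra.subset_adjoin hx
    | algebraMap r =>
      rw [IsScalarTower.algebraMap_apply A B (B ⧸ P.asIdeal)]
      erw [hker]
      exact Subalgebra.algebraMap_mem _ _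
    | add x y _ _ hx hy => exact add_mem hx hy
    | mul x y _ _ hx hy => exact mul_mem hx hy
  obtain ⟨b, hb⟩ := exists_algHom_ne_zero_of_prime (K := K) (B := B ⧸ P.asIdeal)
    (g := Ideal.Quotient.mk P.asIdeal g) (by
      rw [Ne, Ideal.Quotient.eq_zero_iff_mem]; exact hPg)
  refine ⟨b.comp (Ideal.Quotient.mkₐ K P.asIdeal), fun x => ?_, hb⟩
  change b (Ideal.Quotient.mk P.asIdeal (algebraMap A B x)) = _
  rw [hker, AlgHom.commutes]; rfl

open MvPolynomial in
-- The naive presentation has Jacobian `J`; composing with the localization at `J` multiplies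
-- Jacobians, and both factors become units.
theorem isStandardSmooth_localization_jacobian {A : Type*} [CommRing A] {r : ℕ}
    (v : Fin r → MvPolynomial (Fin r) A) (J : MvPolynomial (Fin r) A)
    (hJ : J = Matrix.det (Matrix.of fun i j => pderiv i (v j))) (T : Type*) [CommRing T]
    [Algebra (MvPolynomial (Fin r) A ⧸ (Ideal.span <| Set.range v)) T] [Algebra A T]
    [IsScalarTower A (MvPolynomial (Fin r) A ⧸ (Ideal.span <| Set.range v)) T]
    [IsLocalization.Away (Ideal.Quotient.mk (Ideal.span <| Set.range v) J) T] :
    Algebra.IsStandardSmooth A T := by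
  let S := MvPolynomial (Fin r) A ⧸ (Ideal.span <| Set.range v)
  let N : Algebra.PreSubmersivePresentation A S (Fin r) (Fin r) :=
    Algebra.PreSubmersivePresentation.naive (v := v) id Function.injective_id
  let Q := Algebra.PreSubmersivePresentation.localizationAway T
    (Ideal.Quotient.mk (Ideal.span <| Set.range v) J)
  refine ⟨_, _, inferInstance, inferInstance, ⟨⟨Q.comp N, ?_⟩⟩⟩
  have h1 : N.jacobian = Ideal.Quotient.mk (Ideal.span <| Set.range v) J := by
    rw [Algebra.PreSubmersivePresentation.jacobian_eq_jacobiMatrix_det]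
    have : N.jacobiMatrix = Matrix.of fun i j => pderiv i (v j) :=
      Matrix.ext fun i j => Algebra.PreSubmersivePresentation.jacobiMatrix_naive id
        Function.injective_id _ _ i j
    rw [this, ← hJ]
    rfl
  rw [Algebra.PreSubmersivePresentation.comp_jacobian_eq_jacobian_smul_jacobian,
    Algebra.PreSubmersivePresentation.localizationAway_jacobian, h1, Algebra.smul_def]
  exact (IsLocalization.Away.algebraMap_isUnit _).mul (IsLocalization.Away.algebraMap_isUnit _)

open MvPolynomial in
-- An algebraic implicit function theorem: where the Jacobian is invertible, the zero locus of `v`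
-- is standard smooth, hence flat, over `A`, so that nearby points of `A` lift to it.
theorem exists_algHom_extension_of_jacobian {K A : Type*} [Field K] [IsAlgClosed K] [CommRing A]
    [Algebra K A] {r : ℕ} (v : Fin r → MvPolynomial (Fin r) A)
    (β₀ : MvPolynomial (Fin r) A →ₐ[K] K) (hv : ∀ i, β₀ (v i) = 0)
    (hJ : Matrix.det (Matrix.of fun i j => β₀ (pderiv i (v j))) ≠ 0)
    {g : MvPolynomial (Fin r) A} (hg : β₀ g ≠ 0) :
    ∃ f : A, β₀ (C f) ≠ 0 ∧ ∀ a : A →ₐ[K] K, a f ≠ 0 →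
      ∃ β : MvPolynomial (Fin r) A →ₐ[K] K,
        (∀ x, β (C x) = a x) ∧ (∀ i, β (v i) = 0) ∧ β g ≠ 0 := by
  let J : MvPolynomial (Fin r) A := Matrix.det (Matrix.of fun i j => pderiv i (v j))
  have hJ₀ : β₀ J ≠ 0 := by
    have : β₀ J = Matrix.det (Matrix.of fun i j => β₀ (pderiv i (v j))) := by
      rw [AlgHom.map_det]; rfl
    rwa [this]
  let S := MvPolynomial (Fin r) A ⧸ (Ideal.span <| Set.range v)
  let T := Localization.Away (Ideal.Quotient.mk (Ideal.span <| Set.range v) J)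
  have : Algebra.IsStandardSmooth A T := isStandardSmooth_localization_jacobian v J rfl T
  let π : MvPolynomial (Fin r) A →ₐ[K] S := Ideal.Quotient.mkₐ K _
  let ι : S →ₐ[K] T := IsScalarTower.toAlgHom K S T
  let γ : S →ₐ[K] K := Ideal.Quotient.liftₐ _ β₀ (fun x hx => by
    have : Ideal.span (Set.range v) ≤ RingHom.ker β₀ := by
      rw [Ideal.span_le]; rintro _ ⟨i, rfl⟩; exact hv i
    exact this hx)
  let b₀ : T →ₐ[K] K := IsLocalization.liftAlgHom
    (M := Submonoid.powers (Ideal.Quotient.mk (Ideal.span <| Set.range v) J)) (f := γ) (by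
      rintro ⟨_, n, rfl⟩
      rw [map_pow]
      exact (IsUnit.mk0 _ hJ₀).pow n)
  have hb₀ : ∀ x, b₀ (ι (π x)) = β₀ x := fun x => by
    have : b₀ (algebraMap S T (π x)) = γ (π x) := IsLocalization.lift_eq _ _
    exact this
  have hC : ∀ x : A, algebraMap A T x = ι (π (C x)) := fun x => rfl
  obtain ⟨f, hf, h⟩ := exists_algHom_extension_of_flat (A := A) b₀ (g := ι (π g))
    (by rwa [hb₀])
  refine ⟨f, by rwa [hC, hb₀] at hf, fun a ha => ?_⟩
  obtain ⟨b, hb, hbg⟩ := h a ha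
  refine ⟨b.comp (ι.comp π), fun x => by rw [← hb, hC]; rfl, fun i => ?_, hbg⟩
  have : π (v i) = 0 := Ideal.Quotient.eq_zero_iff_mem.2 (Ideal.subset_span ⟨i, rfl⟩)
  simp [this]

end PointLifting

namespace BoundQuiver

/-! ### Matrix representations over commutative algebras and their blocks -/

section MatrixRepresentations

variable {K Λ S : Type*} [Field K] [Ring Λ] [Algebra K Λ] [CommRing S] [Algebra K S]
  {n m p q : Type*} [Fintype n] [DecidableEq n] [Fintype m] [DecidableEq m]
  [Fintype p] [DecidableEq p] [Fintype q] [DecidableEq q]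

/-- The change of basis of a matrix representation by mutually inverse matrices. -/
def conjRep (σ : Λ →ₐ[K] Matrix n n S) (H : Matrix n m S) (H' : Matrix m n S)
    (h : H * H' = 1) (h' : H' * H = 1) : Λ →ₐ[K] Matrix m m S :=
  AlgHom.ofLinearMap
    { toFun := fun x => H' * σ x * H
      map_add' := fun x y => by rw [map_add, Matrix.mul_add, Matrix.add_mul]
      map_smul' := fun c x => by simp }
    (by simp [h'])
    (fun x y => by
      change H' * σ (x * y) * H = (H' * σ x * H) * (H' * σ y * H)
      rw [map_mul]
      calc H' * (σ x * σ y) * H = H' * σ x * (1 : Matrix n n S) * σ y * H := by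
            rw [Matrix.mul_one]; simp only [Matrix.mul_assoc]
        _ = _ := by rw [← h]; simp only [Matrix.mul_assoc])

@[simp]
theorem conjRep_apply (σ : Λ →ₐ[K] Matrix n n S) (H : Matrix n m S) (H' : Matrix m n S)
    (h : H * H' = 1) (h' : H' * H = 1) (x : Λ) : conjRep σ H H' h h' x = H' * σ x * H := rfl

/-- The representation on the invariant coordinate subspace of a block triangular matrix
representation. -/
def subRep (τ : Λ →ₐ[K] Matrix (p ⊕ q) (p ⊕ q) S) (h : ∀ x, (τ x).toBlocks₂₁ = 0) :
    Λ →ₐ[K] Matrix p p S :=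
  AlgHom.ofLinearMap
    { toFun := fun x => (τ x).toBlocks₁₁
      map_add' := fun x y => by rw [map_add]; rfl
      map_smul' := fun c x => by rw [map_smul]; rfl }
    (by
      change (τ 1).toBlocks₁₁ = 1
      rw [map_one, ← Matrix.fromBlocks_one, Matrix.toBlocks_fromBlocks₁₁])
    (fun x y => by
      change (τ (x * y)).toBlocks₁₁ = (τ x).toBlocks₁₁ * (τ y).toBlocks₁₁
      rw [map_mul, ← Matrix.fromBlocks_toBlocks (τ x), ← Matrix.fromBlocks_toBlocks (τ y),
        Matrix.fromBlocks_multiply, h, h]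
      simp)

/-- The representation on the quotient by the invariant coordinate subspace of a block triangular
matrix representation. -/
def quotRep (τ : Λ →ₐ[K] Matrix (p ⊕ q) (p ⊕ q) S) (h : ∀ x, (τ x).toBlocks₂₁ = 0) :
    Λ →ₐ[K] Matrix q q S :=
  AlgHom.ofLinearMap
    { toFun := fun x => (τ x).toBlocks₂₂
      map_add' := fun x y => by rw [map_add]; rfl
      map_smul' := fun c x => by rw [map_smul]; rfl }
    (by
      change (τ 1).toBlocks₂₂ = 1
      rw [map_one, ← Matrix.fromBlocks_one, Matrix.toBlocks_fromBlocks₂₂])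
    (fun x y => by
      change (τ (x * y)).toBlocks₂₂ = (τ x).toBlocks₂₂ * (τ y).toBlocks₂₂
      rw [map_mul, ← Matrix.fromBlocks_toBlocks (τ x), ← Matrix.fromBlocks_toBlocks (τ y),
        Matrix.fromBlocks_multiply, h, h]
      simp)

@[simp]
theorem subRep_apply (τ : Λ →ₐ[K] Matrix (p ⊕ q) (p ⊕ q) S) (h : ∀ x, (τ x).toBlocks₂₁ = 0)
    (x : Λ) : subRep τ h x = (τ x).toBlocks₁₁ := rfl

@[simp]
theorem quotRep_apply (τ : Λ →ₐ[K] Matrix (p ⊕ q) (p ⊕ q) S) (h : ∀ x, (τ x).toBlocks₂₁ = 0)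
    (x : Λ) : quotRep τ h x = (τ x).toBlocks₂₂ := rfl

/-- The lower unitriangular matrix whose first columns span the graph of `φ`. -/
def graphMatrix (φ : Matrix q p S) : Matrix (p ⊕ q) (p ⊕ q) S := Matrix.fromBlocks 1 0 φ 1

theorem graphMatrix_mul_neg (φ : Matrix q p S) : graphMatrix φ * graphMatrix (-φ) = 1 := by
  simp [graphMatrix, Matrix.fromBlocks_multiply]

theorem graphMatrix_neg_mul (φ : Matrix q p S) : graphMatrix (-φ) * graphMatrix φ = 1 := by
  simp [graphMatrix, Matrix.fromBlocks_multiply]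

/-- The change of basis of a representation which makes the graph of `φ` a coordinate subspace. -/
def shearRep (τ : Λ →ₐ[K] Matrix (p ⊕ q) (p ⊕ q) S) (φ : Matrix q p S) :
    Λ →ₐ[K] Matrix (p ⊕ q) (p ⊕ q) S :=
  conjRep τ (graphMatrix φ) (graphMatrix (-φ)) (graphMatrix_mul_neg φ) (graphMatrix_neg_mul φ)

/-- The lower left block is the obstruction to invariance of the graph of `φ`: a Riccati expression,
quadratic in `φ`. -/
theorem shearRep_apply (τ : Λ →ₐ[K] Matrix (p ⊕ q) (p ⊕ q) S) (φ : Matrix q p S) (x : Λ) :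
    shearRep τ φ x = Matrix.fromBlocks ((τ x).toBlocks₁₁ + (τ x).toBlocks₁₂ * φ)
      (τ x).toBlocks₁₂
      ((τ x).toBlocks₂₁ + (τ x).toBlocks₂₂ * φ - φ * (τ x).toBlocks₁₁
        - φ * ((τ x).toBlocks₁₂ * φ))
      ((τ x).toBlocks₂₂ - φ * (τ x).toBlocks₁₂) := by
  rw [shearRep, conjRep_apply]
  conv_lhs => rw [← Matrix.fromBlocks_toBlocks (τ x)]
  rw [graphMatrix, graphMatrix, Matrix.fromBlocks_multiply, Matrix.fromBlocks_multiply]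
  congr 1 <;> simp [Matrix.add_mul, Matrix.mul_assoc] <;> abel

/-- A derivation-like rule with the diagonal blocks as coefficients. It becomes an honest derivation
rule once these are evaluated at a point where the lower left block vanishes. -/
theorem toBlocks₂₁_mul (τ : Λ →ₐ[K] Matrix (p ⊕ q) (p ⊕ q) S) (x y : Λ) :
    (τ (x * y)).toBlocks₂₁ = (τ x).toBlocks₂₁ * (τ y).toBlocks₁₁ +
      (τ x).toBlocks₂₂ * (τ y).toBlocks₂₁ := by
  rw [map_mul, ← Matrix.fromBlocks_toBlocks (τ x), ← Matrix.fromBlocks_toBlocks (τ y),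
    Matrix.fromBlocks_multiply]
  simp

end MatrixRepresentations

/-! ### Deforming a submodule along a family -/

section GraphLifting

open MvPolynomial

variable {K Λ A : Type*} [Field K] [Ring Λ] [Algebra K Λ]
  [CommRing A] [Algebra K A] {p q : Type*} [Fintype p] [DecidableEq p] [Fintype q] [DecidableEq q]

/-- Lift a basis of the image of `T` and extend its coordinate functionals. The `h j` will be the
directions of a slice and the `l i` will select as many equations. -/
theorem exists_dual_families {K V W : Type*} [Field K] [AddCommGroup V] [Module K V]
    [FiniteDimensional K V] [AddCommGroup W] [Module K W] (T : V →ₗ[K] W) :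
    ∃ (r : ℕ) (h : Fin r → V) (l : Fin r → W →ₗ[K] K),
      (∀ i j, l i (T (h j)) = if i = j then 1 else 0) ∧
      ∀ w ∈ LinearMap.range T, (∀ i, l i w = 0) → w = 0 := by
  let b := Module.finBasis K (LinearMap.range T)
  choose h hh using fun i => (b i).2
  choose l hl using fun i => LinearMap.exists_extend (b.coord i)
  refine ⟨_, h, l, fun i j => ?_, fun w hw h0 => ?_⟩
  · rw [hh]
    have := LinearMap.congr_fun (hl i) (b j)
    simp only [LinearMap.comp_apply, Submodule.subtype_apply] at this
    rw [this, Module.Basis.coord_apply, Module.Basis.repr_self, Finsupp.single_apply]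
    simp only [eq_comm]
  · have : (⟨w, hw⟩ : LinearMap.range T) = 0 := by
      refine b.ext_elem fun i => ?_
      have := LinearMap.congr_fun (hl i) ⟨w, hw⟩
      simp only [LinearMap.comp_apply, Submodule.subtype_apply, h0] at this
      simpa using this.symm
    exact congrArg Subtype.val this

/-- Nakayama's lemma for the image of `I` in `R ⧸ J`. Only `I` needs to be finitely generated. -/
theorem exists_mul_mem_of_le_sup {R : Type*} [CommRing R] {I J m : Ideal R} (hI : I.FG)
    (h : I ≤ J ⊔ m * I) : ∃ g : R, g - 1 ∈ m ∧ ∀ x ∈ I, g * x ∈ J := by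
  let N : Submodule R (R ⧸ J) := Submodule.map J.mkQ I
  have hN : N.FG := Submodule.FG.map _ hI
  have hle : N ≤ m • N := by
    rintro _ ⟨x, hx, rfl⟩
    obtain ⟨y, hy, z, hz, rfl⟩ := Submodule.mem_sup.1 (h hx)
    rw [map_add, show J.mkQ y = 0 from (Submodule.Quotient.mk_eq_zero J).2 hy, zero_add]
    rw [← Submodule.map_smul'']
    exact Submodule.mem_map_of_mem hz
  obtain ⟨g, hg, hgN⟩ := Submodule.exists_sub_one_mem_and_smul_eq_zero_of_fg_of_le_smul m N hN hle
  refine ⟨g, hg, fun x hx => ?_⟩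
  have := hgN (J.mkQ x) (Submodule.mem_map_of_mem hx)
  rw [← map_smul] at this
  exact (Submodule.Quotient.mk_eq_zero J).1 this

/-- The coefficients, with respect to matrix units, of a functional on families of matrices. -/
theorem functional_eq_sum {K ι : Type*} [Field K] [Fintype ι] [DecidableEq ι]
    (l : (ι → Matrix q p K) →ₗ[K] K) (F : ι → Matrix q p K) :
    l F = ∑ k, ∑ i, ∑ j, l (Pi.single k (Matrix.single i j 1)) * F k i j := by
  conv_lhs => rw [← Finset.univ_sum_single F, map_sum]
  refine Finset.sum_congr rfl fun k _ => ?_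
  have h : ∀ i j, l (Pi.single k (Matrix.single i j 1)) * F k i j =
      l.comp (LinearMap.single K (fun _ : ι => Matrix q p K) k) (Matrix.single i j (F k i j)) := by
    intro i j
    rw [mul_comm, ← smul_eq_mul, ← map_smul, LinearMap.comp_apply, LinearMap.single_apply,
      ← Pi.single_smul, Matrix.smul_single, smul_eq_mul, mul_one]
  simp_rw [h, ← map_sum, ← Matrix.matrix_eq_sum_single]
  rfl

theorem map_mul_of_leibniz {R l m n : Type*} [CommRing R] [Algebra K R] [Fintype m]
    (β : R →ₐ[K] K) (D : R →ₗ[K] K) (hD : ∀ x y, D (x * y) = β x * D y + D x * β y)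
    (M : Matrix l m R) (N : Matrix m n R) :
    (M * N).map D = M.map β * N.map D + M.map D * N.map β := by
  ext i j
  simp only [Matrix.map_apply, Matrix.mul_apply, Matrix.add_apply, map_sum, hD,
    Finset.sum_add_distrib]

theorem mem_of_forall_functional {R : Type*} [AddCommGroup R] [Module K R] (N : Submodule K R)
    (x : R) (h : ∀ θ : R →ₗ[K] K, N ≤ LinearMap.ker θ → θ x = 0) : x ∈ N := by
  by_contra hx
  obtain ⟨θ, hθ, hN⟩ := N.exists_le_ker_of_notMem hx
  exact hθ (h θ hN)

/-- If every derivation at `a₀` is inner, the invariant coordinate subspace at `a₀` deforms to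
invariant graphs over a neighbourhood. The function `g` is a further open condition on the
deformation, to be chosen after `φ`. -/
theorem exists_graph_lifting [IsAlgClosed K] [FiniteDimensional K Λ]
    (σ : Λ →ₐ[K] Matrix (p ⊕ q) (p ⊕ q) A) (a₀ : A →ₐ[K] K)
    (h0 : ∀ x, ((σ x).map a₀).toBlocks₂₁ = 0)
    (hder : ∀ δ : Λ →ₗ[K] Matrix q p K,
      (∀ x y, δ (x * y) = δ x * ((σ y).map a₀).toBlocks₁₁ + ((σ x).map a₀).toBlocks₂₂ * δ y) →
      ∃ h : Matrix q p K, ∀ x, δ x = ((σ x).map a₀).toBlocks₂₂ * h - h * ((σ x).map a₀).toBlocks₁₁) :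
    ∃ (r : ℕ) (φ : Matrix q p (MvPolynomial (Fin r) A)) (β₀ : MvPolynomial (Fin r) A →ₐ[K] K),
      (∀ x, β₀ (C x) = a₀ x) ∧ φ.map β₀ = 0 ∧ ∀ g, β₀ g ≠ 0 → ∃ f : A, a₀ f ≠ 0 ∧
        ∀ a : A →ₐ[K] K, a f ≠ 0 → ∃ β : MvPolynomial (Fin r) A →ₐ[K] K,
          (∀ x, β (C x) = a x) ∧ (∀ x, ((shearRep ((IsScalarTower.toAlgHom K A
            (MvPolynomial (Fin r) A)).mapMatrix.comp σ) φ x).map β).toBlocks₂₁ = 0) ∧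
          β g ≠ 0 := by
  let e := Module.finBasis K Λ
  -- `T h` is the inner derivation of `h`, recorded on a basis of `Λ`; it is the linear part of the
  -- invariance equations at `φ = 0`.
  let T : Matrix q p K →ₗ[K] (Fin (Module.finrank K Λ) → Matrix q p K) :=
    { toFun := fun h k => ((σ (e k)).map a₀).toBlocks₂₂ * h - h * ((σ (e k)).map a₀).toBlocks₁₁
      map_add' := fun h h' => by
        funext k
        simp only [Pi.add_apply, Matrix.mul_add, Matrix.add_mul]; abel
      map_smul' := fun c h => by
        funext k
        simp [smul_sub] }
  obtain ⟨r, h, l, hl, hT⟩ := exists_dual_families T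
  let R := MvPolynomial (Fin r) A
  let φ : Matrix q p R := Matrix.of fun a b => ∑ i, algebraMap K R (h i a b) * X i
  let τ := (IsScalarTower.toAlgHom K A R).mapMatrix.comp σ
  let ρ := shearRep τ φ
  let F : Λ → Matrix q p R := fun x => (ρ x).toBlocks₂₁
  -- `v i` is the functional `l i`, with scalars extended to `R`, applied to the obstruction `F`.
  let v : Fin r → R := fun i =>
    ∑ k, ∑ a, ∑ b, algebraMap K R (l i (Pi.single k (Matrix.single a b 1))) * F (e k) a b
  let β₀ : R →ₐ[K] K := MvPolynomial.aevalTower a₀ (fun _ => 0)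
  have hβC : ∀ x, β₀ (C x) = a₀ x := fun x => MvPolynomial.aevalTower_C _ _ _
  have hβX : ∀ i, β₀ (X i) = 0 := fun i => MvPolynomial.aevalTower_X _ _ _
  have hφ : φ.map β₀ = 0 := by
    ext a b
    simp [φ, hβX]
  have hτ : ∀ x, (τ x).map β₀ = (σ x).map a₀ := fun x => by
    ext i j
    exact hβC _
  have hρ : ∀ x, (ρ x).map β₀ = (σ x).map a₀ := fun x => by
    rw [← hτ]
    have hg : (graphMatrix φ).map β₀ = 1 := by
      rw [graphMatrix, Matrix.fromBlocks_map, hφ]; simp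
    have hg' : (graphMatrix (-φ)).map β₀ = 1 := by
      rw [graphMatrix, Matrix.fromBlocks_map, Matrix.map_neg _ (map_neg β₀), hφ]; simp
    change (graphMatrix (-φ) * τ x * graphMatrix φ).map β₀ = _
    rw [Matrix.map_mul, Matrix.map_mul, hg, hg', Matrix.one_mul, Matrix.mul_one]
  have hF0 : ∀ x, (F x).map β₀ = 0 := fun x => by
    rw [← h0 x, ← hρ]; rfl
  refine ⟨r, φ, β₀, hβC, hφ, fun g hg => ?_⟩
  let I : Ideal R := Ideal.span (Set.range fun t : Fin (Module.finrank K Λ) × q × p =>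
    F (e t.1) t.2.1 t.2.2)
  have hFI : ∀ x a b, F x a b ∈ I := by
    intro x a b
    let Fl : Λ →ₗ[K] R :=
      { toFun := fun x => F x a b
        map_add' := fun x y => by simp [F, Matrix.toBlocks₂₁]
        map_smul' := fun c x => by simp [F, Matrix.toBlocks₂₁] }
    have : Fl x ∈ I := by
      rw [← e.sum_repr x, map_sum]
      refine sum_mem fun k _ => ?_
      rw [map_smul]
      exact Submodule.smul_of_tower_mem I _ (Ideal.subset_span ⟨(k, a, b), rfl⟩)
    exact this
  let J : Ideal R := Ideal.span (Set.range v)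
  -- Dually: a `K`-functional which kills `J` and `ker β₀ * I` must kill the generators of `I`.
  have hIJ : I ≤ J ⊔ RingHom.ker β₀ * I := by
    rw [Ideal.span_le]
    rintro _ ⟨⟨k, a, b⟩, rfl⟩
    refine mem_of_forall_functional ((J ⊔ RingHom.ker β₀ * I).restrictScalars K) _
      fun θ hθ => ?_
    have hθ' : ∀ x ∈ J ⊔ RingHom.ker β₀ * I, θ x = 0 := fun x hx => hθ hx
    let δ : Λ →ₗ[K] Matrix q p K :=
      { toFun := fun x => (F x).map θ
        map_add' := fun x y => by ext a b; simp [F, Matrix.toBlocks₂₁]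
        map_smul' := fun c x => by ext a b; simp [F, Matrix.toBlocks₂₁] }
    -- On `I`, `θ` sees coefficients only through `β₀`. Hence `θ ∘ F` is a derivation at `a₀`, and
    -- so inner.
    have key : ∀ x ∈ I, ∀ y, θ (x * y) = θ x * β₀ y := fun x hx y => by
      have : θ ((y - algebraMap K R (β₀ y)) * x) = 0 :=
        hθ' _ (Ideal.mem_sup_right (Ideal.mul_mem_mul (by simp [RingHom.mem_ker]) hx))
      rw [sub_mul, map_sub, sub_eq_zero, ← Algebra.smul_def, map_smul, smul_eq_mul] at this
      rw [mul_comm x, this, mul_comm]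
    obtain ⟨u, hu⟩ := hder δ fun x y => by
      ext a b
      change θ (F (x * y) a b) = _
      have : F (x * y) = F x * (ρ y).toBlocks₁₁ + (ρ x).toBlocks₂₂ * F y := toBlocks₂₁_mul ρ x y
      rw [this, ← hρ, ← hρ]
      simp only [Matrix.add_apply, Matrix.mul_apply, map_add, map_sum]
      congr 1
      · exact Finset.sum_congr rfl fun c _ => key _ (hFI _ _ _) _
      · refine Finset.sum_congr rfl fun c _ => ?_
        rw [mul_comm, key _ (hFI _ _ _), mul_comm]; rfl
    -- The inner derivation `δ` lies in the image of `T` and is killed by every `l i`, because `θ (v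
    -- i) = 0`.
    have h1 : (fun k => δ (e k)) = 0 := by
      refine hT _ ⟨u, ?_⟩ fun i => ?_
      · funext k; exact (hu (e k)).symm
      · rw [functional_eq_sum]
        have : θ (v i) = 0 := hθ' _ (Ideal.mem_sup_left (Ideal.subset_span ⟨i, rfl⟩))
        simp only [v, map_sum, ← Algebra.smul_def, map_smul, smul_eq_mul] at this
        exact this
    exact congrFun (congrFun (congrFun h1 k) a) b
  obtain ⟨s, hs, hsI⟩ := exists_mul_mem_of_le_sup
    (Submodule.fg_span (Set.finite_range _)) hIJ
  have hβs : β₀ s = 1 := by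
    rw [RingHom.mem_ker, map_sub, map_one, sub_eq_zero] at hs
    exact hs
  have hv : ∀ i, β₀ (v i) = 0 := fun i => by
    have : ∀ x a b, β₀ (F x a b) = 0 := fun x a b => congrFun (congrFun (hF0 x) a) b
    simp [v, this]
  -- The derivative of `F` at `φ = 0` in direction `i` is `T (h i)`, so by duality the Jacobian
  -- matrix is the identity.
  have hJ : Matrix.det (Matrix.of fun i j => β₀ (pderiv i (v j))) ≠ 0 := by
    have : (Matrix.of fun i j => β₀ (pderiv i (v j))) = 1 := by
      ext i j
      let D : R →ₗ[K] K := β₀.toLinearMap.comp ((pderiv i).restrictScalars K).toLinearMap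
      have hD : ∀ x y, D (x * y) = β₀ x * D y + D x * β₀ y := fun x y => by
        simp [D, Derivation.leibniz]; ring
      have hDC : ∀ x, D (C x) = 0 := fun x =>
        (congrArg β₀ pderiv_C).trans (map_zero β₀)
      have hDX : ∀ k, D (X k) = if k = i then 1 else 0 := fun k => by
        refine (congrArg β₀ (pderiv_X i k)).trans ?_
        rw [Pi.single_apply]
        split_ifs <;> simp
      have hDφ : φ.map D = h i := by
        ext a b
        simp only [φ, Matrix.map_apply, Matrix.of_apply, map_sum, ← Algebra.smul_def, map_smul, hDX]
        simp
      have hDτ : ∀ x, (τ x).map D = 0 := fun x => by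
        ext a b; exact hDC _
      have hDF : (fun k => (F (e k)).map D) = T (h i) := by
        funext k
        have hb : ∀ x, ((τ x).toBlocks₁₁.map β₀ = ((σ x).map a₀).toBlocks₁₁ ∧
            (τ x).toBlocks₁₂.map β₀ = ((σ x).map a₀).toBlocks₁₂ ∧
            (τ x).toBlocks₂₂.map β₀ = ((σ x).map a₀).toBlocks₂₂) := fun x => by
          rw [← hτ]; exact ⟨rfl, rfl, rfl⟩
        have hd : ∀ x, ((τ x).toBlocks₁₁.map D = 0 ∧ (τ x).toBlocks₂₁.map D = 0 ∧
            (τ x).toBlocks₂₂.map D = 0) := fun x =>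
          ⟨congrArg Matrix.toBlocks₁₁ (hDτ x), congrArg Matrix.toBlocks₂₁ (hDτ x),
            congrArg Matrix.toBlocks₂₂ (hDτ x)⟩
        change ((shearRep τ φ (e k)).toBlocks₂₁).map D = ((σ (e k)).map a₀).toBlocks₂₂ * h i -
          h i * ((σ (e k)).map a₀).toBlocks₁₁
        rw [shearRep_apply, Matrix.toBlocks_fromBlocks₂₁, Matrix.map_sub _ (map_sub D),
          Matrix.map_sub _ (map_sub D), Matrix.map_add _ (map_add D),
          map_mul_of_leibniz β₀ D hD, map_mul_of_leibniz β₀ D hD,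
          map_mul_of_leibniz β₀ D hD, Matrix.map_mul (f := β₀)]
        simp only [(hd _).1, (hd _).2.1, (hd _).2.2, hφ, hDφ,
          (hb _).1, (hb _).2.2]
        simp
      change D (v j) = _
      have := functional_eq_sum (l j) (T (h i))
      rw [hl, ← hDF] at this
      simp only [v, map_sum, ← Algebra.smul_def, map_smul, smul_eq_mul]
      rw [Matrix.one_apply]
      rw [show (if i = j then (1 : K) else 0) = if j = i then 1 else 0 by simp only [eq_comm], this]
      rfl
    rw [this, Matrix.det_one]
    exact one_ne_zero
  -- Where `s` is nonzero, `s * I ≤ J` turns the selected equations `v = 0` into `F = 0`.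
  obtain ⟨f, hf, hfa⟩ := exists_algHom_extension_of_jacobian v β₀ hv hJ (g := s * g) (by
    rw [map_mul, hβs, one_mul]; exact hg)
  refine ⟨f, by rwa [hβC] at hf, fun a ha => ?_⟩
  obtain ⟨β, hβ, hβv, hβg⟩ := hfa a ha
  rw [map_mul] at hβg
  refine ⟨β, hβ, fun x => ?_, right_ne_zero_of_mul hβg⟩
  ext i j
  have h2 : β (s * F x i j) = 0 := by
    have : J ≤ RingHom.ker β := by
      rw [Ideal.span_le]; rintro _ ⟨i, rfl⟩; exact hβv i
    exact this (hsI _ (hFI x i j))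
  rw [map_mul] at h2
  exact (mul_eq_zero.1 h2).resolve_left (left_ne_zero_of_mul hβg)

end GraphLifting

end BoundQuiver

namespace BoundQuiver

open CategoryTheory

/-! ### Vanishing of `Ext¹` and extensions of modules -/

section Extensions

variable {Λ : Type u} [Ring Λ]

theorem prop_of_linearEquiv {X : ObjectProperty (ModuleCat.{u} Λ)}
    [X.IsClosedUnderIsomorphisms] {M N : Type u} [AddCommGroup M] [Module Λ M] [AddCommGroup N]
    [Module Λ N] (e : M ≃ₗ[Λ] N) (h : X (ModuleCat.of Λ M)) : X (ModuleCat.of Λ N) :=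
  X.prop_of_iso e.toModuleIso h

theorem shortExact_of_exact {A M C : ModuleCat.{u} Λ} (i : A →ₗ[Λ] M) (p : M →ₗ[Λ] C)
    (hi : Function.Injective i) (hp : Function.Surjective p) (h : Function.Exact i p) :
    (ShortComplex.mk (ModuleCat.ofHom i) (ModuleCat.ofHom p)
      (by ext x; exact h.apply_apply_eq_zero x)).ShortExact where
  exact := by
    rw [ShortComplex.ShortExact.moduleCat_exact_iff_function_exact]
    exact h
  mono_f := (ModuleCat.mono_iff_injective _).2 hi
  epi_g := (ModuleCat.epi_iff_surjective _).2 hp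

/-- The obstruction to lifting the identity of `C` along `p` is its image in `Ext¹(C, A)`. -/
theorem exists_section_of_subsingleton_ext {A M C : ModuleCat.{u} Λ} (i : A →ₗ[Λ] M)
    (p : M →ₗ[Λ] C) (hi : Function.Injective i) (hp : Function.Surjective p)
    (h : Function.Exact i p) [Subsingleton (Abelian.Ext.{u} C A 1)] :
    ∃ s : C →ₗ[Λ] M, p ∘ₗ s = LinearMap.id := by
  obtain ⟨x, hx⟩ := Abelian.Ext.covariant_sequence_exact₃ C (shortExact_of_exact i p hi hp h)
    (Abelian.Ext.mk₀ (𝟙 C)) (zero_add 1) (Subsingleton.elim _ _)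
  obtain ⟨s, rfl⟩ := (Abelian.Ext.mk₀_bijective _ _).2 x
  refine ⟨s.hom, ?_⟩
  rw [Abelian.Ext.mk₀_comp_mk₀] at hx
  have := (Abelian.Ext.mk₀_bijective _ _).1 hx
  exact congrArg ModuleCat.Hom.hom this

theorem subsingleton_ext_of_exact {A M C B : ModuleCat.{u} Λ} (i : A →ₗ[Λ] M)
    (p : M →ₗ[Λ] C) (hi : Function.Injective i) (hp : Function.Surjective p)
    (h : Function.Exact i p) [Subsingleton (Abelian.Ext.{u} B A 1)]
    [Subsingleton (Abelian.Ext.{u} B C 1)] : Subsingleton (Abelian.Ext.{u} B M 1) := by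
  refine subsingleton_of_forall_eq 0 fun x => ?_
  obtain ⟨y, rfl⟩ := Abelian.Ext.covariant_sequence_exact₂ B (shortExact_of_exact i p hi hp h)
    x (Subsingleton.elim _ _)
  rw [Subsingleton.elim y 0, Abelian.Ext.zero_comp]

theorem subsingleton_ext_of_subsingleton {A B : ModuleCat.{u} Λ} [Subsingleton A] :
    Subsingleton (Abelian.Ext.{u} B A 1) := by
  refine subsingleton_of_forall_eq 0 fun x => ?_
  rw [← Abelian.Ext.comp_mk₀_id x, (ModuleCat.isZero_of_subsingleton A).eq_of_src (𝟙 A) 0,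
    Abelian.Ext.mk₀_zero, Abelian.Ext.comp_zero]

/-- The modules which possess a submodule in `X` with quotient in `Z`. -/
def ExtensionProperty (X Z : ObjectProperty (ModuleCat.{u} Λ)) :
    ObjectProperty (ModuleCat.{u} Λ) :=
  fun M => ∃ U : Submodule Λ M, X (ModuleCat.of Λ U) ∧ Z (ModuleCat.of Λ (M ⧸ U))

theorem extensionProperty_of_exact {X Z : ObjectProperty (ModuleCat.{u} Λ)}
    [X.IsClosedUnderIsomorphisms] [Z.IsClosedUnderIsomorphisms] {A M C : Type u}
    [AddCommGroup A] [Module Λ A] [AddCommGroup M] [Module Λ M] [AddCommGroup C] [Module Λ C]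
    (i : A →ₗ[Λ] M) (p : M →ₗ[Λ] C) (hi : Function.Injective i) (hp : Function.Surjective p)
    (h : Function.Exact i p) (hA : X (ModuleCat.of Λ A)) (hC : Z (ModuleCat.of Λ C)) :
    ExtensionProperty X Z (ModuleCat.of Λ M) := by
  refine ⟨LinearMap.range i, prop_of_linearEquiv (LinearEquiv.ofInjective i hi) hA, ?_⟩
  rw [← (LinearMap.exact_iff.1 h)]
  exact prop_of_linearEquiv (p.quotKerEquivOfSurjective hp).symm hC

instance (X Z : ObjectProperty (ModuleCat.{u} Λ)) [X.IsClosedUnderIsomorphisms]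
    [Z.IsClosedUnderIsomorphisms] : (ExtensionProperty X Z).IsClosedUnderIsomorphisms where
  of_iso {M N} e := by
    rintro ⟨U, hU, hZ⟩
    let f := e.toLinearEquiv
    refine extensionProperty_of_exact (M := N) (f.toLinearMap ∘ₗ U.subtype)
      (U.mkQ ∘ₗ f.symm.toLinearMap) (f.injective.comp U.subtype_injective)
      (U.mkQ_surjective.comp f.symm.surjective) (fun y => ?_) hU hZ
    constructor
    · intro hy
      exact ⟨⟨f.symm y, (Submodule.Quotient.mk_eq_zero U).1 hy⟩, by simp⟩
    · rintro ⟨x, rfl⟩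
      simp

end Extensions

/-! ### Modules of matrix representations; derivations and `Ext¹` -/

section RepSpaces

variable {K Λ : Type u} [Field K] [Ring Λ] [Algebra K Λ]
  {n m p q : Type} [Fintype n] [DecidableEq n] [Fintype m] [DecidableEq m]
  [Fintype p] [DecidableEq p] [Fintype q] [DecidableEq q]

/-- The space of column vectors, as a module via a matrix representation. -/
def RepSpace (_σ : Λ →ₐ[K] Matrix n n K) : Type u := n → K

instance (σ : Λ →ₐ[K] Matrix n n K) : AddCommGroup (RepSpace σ) :=
  inferInstanceAs (AddCommGroup (n → K))

instance (σ : Λ →ₐ[K] Matrix n n K) : Module K (RepSpace σ) :=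
  inferInstanceAs (Module K (n → K))

instance (σ : Λ →ₐ[K] Matrix n n K) : FiniteDimensional K (RepSpace σ) :=
  inferInstanceAs (FiniteDimensional K (n → K))

/-- The column vector which underlies an element of the module of a matrix representation. -/
def RepSpace.vec (σ : Λ →ₐ[K] Matrix n n K) : RepSpace σ ≃ₗ[K] (n → K) :=
  LinearEquiv.refl K (n → K)

theorem RepSpace.ext {σ : Λ →ₐ[K] Matrix n n K} {v w : RepSpace σ}
    (h : RepSpace.vec σ v = RepSpace.vec σ w) : v = w := (RepSpace.vec σ).injective h

instance (σ : Λ →ₐ[K] Matrix n n K) : SMul Λ (RepSpace σ) where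
  smul x v := (RepSpace.vec σ).symm ((σ x).mulVec (RepSpace.vec σ v))

@[simp]
theorem RepSpace.vec_smul (σ : Λ →ₐ[K] Matrix n n K) (x : Λ) (v : RepSpace σ) :
    RepSpace.vec σ (x • v) = (σ x).mulVec (RepSpace.vec σ v) := rfl

instance (σ : Λ →ₐ[K] Matrix n n K) : Module Λ (RepSpace σ) where
  one_smul v := RepSpace.ext (by simp)
  mul_smul x y v := RepSpace.ext (by simp)
  smul_zero x := RepSpace.ext (by simp)
  smul_add x v w := RepSpace.ext (by simp [Matrix.mulVec_add])
  add_smul x y v := RepSpace.ext (by simp [Matrix.add_mulVec])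
  zero_smul v := RepSpace.ext (by simp)

instance (σ : Λ →ₐ[K] Matrix n n K) : IsScalarTower K Λ (RepSpace σ) where
  smul_assoc c x v := RepSpace.ext (by simp [Matrix.smul_mulVec])

/-- A matrix representation, as a module. -/
abbrev repMod (σ : Λ →ₐ[K] Matrix n n K) : ModuleCat.{u} Λ := ModuleCat.of Λ (RepSpace σ)

/-- Conjugate matrix representations define isomorphic modules. -/
def conjRepEquiv (σ : Λ →ₐ[K] Matrix n n K) (H : Matrix n m K) (H' : Matrix m n K)
    (h : H * H' = 1) (h' : H' * H = 1) : RepSpace (conjRep σ H H' h h') ≃ₗ[Λ] RepSpace σ where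
  toFun v := (RepSpace.vec _).symm (H.mulVec (RepSpace.vec _ v))
  invFun v := (RepSpace.vec _).symm (H'.mulVec (RepSpace.vec _ v))
  left_inv v := RepSpace.ext (by simp [h'])
  right_inv v := RepSpace.ext (by simp [h])
  map_add' v w := RepSpace.ext (by simp [Matrix.mulVec_add])
  map_smul' x v := RepSpace.ext (by simp [← Matrix.mul_assoc, h])

/-- The inclusion of the invariant coordinate subspace. -/
def subRepIncl (τ : Λ →ₐ[K] Matrix (p ⊕ q) (p ⊕ q) K) (h : ∀ x, (τ x).toBlocks₂₁ = 0) :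
    RepSpace (subRep τ h) →ₗ[Λ] RepSpace τ where
  toFun v := (RepSpace.vec _).symm (Sum.elim (RepSpace.vec _ v) 0)
  map_add' v w := RepSpace.ext (by
    funext i; cases i <;> simp)
  map_smul' x v := RepSpace.ext (by
    simp only [RepSpace.vec_smul, LinearEquiv.apply_symm_apply, RingHom.id_apply, subRep_apply]
    conv_rhs => rw [← Matrix.fromBlocks_toBlocks (τ x), h]
    rw [Matrix.fromBlocks_mulVec]
    simp)

/-- The projection onto the quotient by the invariant coordinate subspace. -/
def quotRepProj (τ : Λ →ₐ[K] Matrix (p ⊕ q) (p ⊕ q) K) (h : ∀ x, (τ x).toBlocks₂₁ = 0) :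
    RepSpace τ →ₗ[Λ] RepSpace (quotRep τ h) where
  toFun v := (RepSpace.vec _).symm (RepSpace.vec _ v ∘ Sum.inr)
  map_add' v w := rfl
  map_smul' x v := RepSpace.ext (by
    simp only [RepSpace.vec_smul, LinearEquiv.apply_symm_apply, RingHom.id_apply, quotRep_apply]
    conv_lhs => rw [← Matrix.fromBlocks_toBlocks (τ x), h]
    rw [Matrix.fromBlocks_mulVec]
    simp)

theorem subRepIncl_injective (τ : Λ →ₐ[K] Matrix (p ⊕ q) (p ⊕ q) K)
    (h : ∀ x, (τ x).toBlocks₂₁ = 0) : Function.Injective (subRepIncl τ h) := fun _ _ hvw =>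
  funext fun i => congrFun hvw (Sum.inl i)

theorem quotRepProj_surjective (τ : Λ →ₐ[K] Matrix (p ⊕ q) (p ⊕ q) K)
    (h : ∀ x, (τ x).toBlocks₂₁ = 0) : Function.Surjective (quotRepProj τ h) := fun v =>
  ⟨(Sum.elim 0 v : p ⊕ q → K), rfl⟩

theorem subRepIncl_quotRepProj_exact (τ : Λ →ₐ[K] Matrix (p ⊕ q) (p ⊕ q) K)
    (h : ∀ x, (τ x).toBlocks₂₁ = 0) : Function.Exact (subRepIncl τ h) (quotRepProj τ h) := by
  intro v
  constructor
  · intro hv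
    refine ⟨fun i => v (Sum.inl i), ?_⟩
    funext i
    cases i with
    | inl i => rfl
    | inr j => exact (congrFun hv j).symm
  · rintro ⟨w, rfl⟩
    rfl

/-- Block triangular representations are extensions. -/
theorem extensionProperty_repMod {X Z : ObjectProperty (ModuleCat.{u} Λ)}
    [X.IsClosedUnderIsomorphisms] [Z.IsClosedUnderIsomorphisms]
    (τ : Λ →ₐ[K] Matrix (p ⊕ q) (p ⊕ q) K) (h : ∀ x, (τ x).toBlocks₂₁ = 0)
    (hX : X (repMod (subRep τ h))) (hZ : Z (repMod (quotRep τ h))) :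
    ExtensionProperty X Z (repMod τ) :=
  extensionProperty_of_exact _ _ (subRepIncl_injective τ h) (quotRepProj_surjective τ h)
    (subRepIncl_quotRepProj_exact τ h) hX hZ

/-- Derivations with values in an extension-rigid pair of representations are inner. -/
theorem exists_inner_of_subsingleton_ext (α : Λ →ₐ[K] Matrix p p K) (γ : Λ →ₐ[K] Matrix q q K)
    [Subsingleton (Abelian.Ext.{u} (repMod α) (repMod γ) 1)] (δ : Λ →ₗ[K] Matrix q p K)
    (hδ : ∀ x y, δ (x * y) = δ x * α y + γ x * δ y) :
    ∃ h : Matrix q p K, ∀ x, δ x = γ x * h - h * α x := by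
  -- The derivation rule makes `δ` the off-diagonal block of an extension of `α` by `γ`; applied to
  -- `1 * 1` it gives `δ 1 = 0`.
  let τ : Λ →ₐ[K] Matrix (q ⊕ p) (q ⊕ p) K := AlgHom.ofLinearMap
    { toFun := fun x => Matrix.fromBlocks (γ x) (δ x) 0 (α x)
      map_add' := fun x y => by simp [Matrix.fromBlocks_add]
      map_smul' := fun c x => by simp [Matrix.fromBlocks_smul] }
    (by
      have h1 := hδ 1 1
      simp only [mul_one, map_one, Matrix.mul_one, Matrix.one_mul, left_eq_add] at h1
      simp [h1])
    (fun x y => by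
      simp [Matrix.fromBlocks_multiply, hδ, add_comm])
  have hτ : ∀ x, τ x = Matrix.fromBlocks (γ x) (δ x) 0 (α x) := fun _ => rfl
  have h21 : ∀ x, (τ x).toBlocks₂₁ = 0 := fun x => by rw [hτ, Matrix.toBlocks_fromBlocks₂₁]
  have hsub : subRep τ h21 = γ := by
    ext1 x; rw [subRep_apply, hτ, Matrix.toBlocks_fromBlocks₁₁]
  have hquot : quotRep τ h21 = α := by
    ext1 x; rw [quotRep_apply, hτ, Matrix.toBlocks_fromBlocks₂₂]
  have : Subsingleton (Abelian.Ext.{u} (repMod (quotRep τ h21)) (repMod (subRep τ h21)) 1) := by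
    rw [hsub, hquot]; infer_instance
  obtain ⟨s, hs⟩ : ∃ s : RepSpace (quotRep τ h21) →ₗ[Λ] RepSpace τ,
      quotRepProj τ h21 ∘ₗ s = LinearMap.id := exists_section_of_subsingleton_ext (A := repMod (subRep τ h21))
    (M := repMod τ) (C := repMod (quotRep τ h21)) _ _ (subRepIncl_injective τ h21)
    (quotRepProj_surjective τ h21) (subRepIncl_quotRepProj_exact τ h21)
  let s' : (p → K) → (q ⊕ p → K) := fun v =>
    RepSpace.vec τ (s ((RepSpace.vec (quotRep τ h21)).symm v))
  have hsα : ∀ (x : Λ) (v : p → K), s' ((α x).mulVec v) = (τ x).mulVec (s' v) := by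
    intro x v
    change _ = RepSpace.vec τ (x • _)
    rw [← s.map_smul]
    simp only [s']
    congr 2
  have hsr : ∀ (v : p → K) (j : p), s' v (Sum.inr j) = v j := fun v j =>
    congrFun (LinearMap.congr_fun hs ((RepSpace.vec (quotRep τ h21)).symm v)) j
  have hsK : ∀ (c : K) (v : p → K), s' (c • v) = c • s' v := by
    intro c v
    have := hsα (algebraMap K Λ c) v
    rw [AlgHom.commutes, AlgHom.commutes] at this
    simpa [Algebra.algebraMap_eq_smul_one, Matrix.smul_mulVec] using this
  have hsa : ∀ v w : p → K, s' (v + w) = s' v + s' w := by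
    intro v w
    simp only [s', map_add]
  let u : (p → K) →ₗ[K] (q → K) :=
    { toFun := fun v i => s' v (Sum.inl i)
      map_add' := fun v w => by
        funext i
        rw [hsa]; rfl
      map_smul' := fun c v => by
        funext i
        rw [hsK]; rfl }
  -- The section is the graph of `u`. Its linearity over `Λ` reads `u α = γ u + δ`, whence the sign
  -- in the witness `-u`.
  have hu : ∀ v, s' v = Sum.elim (u v) v := fun v => by
    funext i
    cases i with
    | inl i => rfl
    | inr j => exact hsr v j
  have key : ∀ (x : Λ) v, u ((α x).mulVec v) = (γ x).mulVec (u v) + (δ x).mulVec v := by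
    intro x v
    have := hsα x v
    rw [hu, hu, hτ, Matrix.fromBlocks_mulVec] at this
    funext i
    have h2 := congrFun this (Sum.inl i)
    simpa using h2
  refine ⟨-LinearMap.toMatrix' u, fun x => ?_⟩
  have hmul : ∀ v, (LinearMap.toMatrix' u).mulVec v = u v := fun v =>
    LinearMap.toMatrix'_mulVec u v
  refine Matrix.toLin'.injective (LinearMap.ext fun v => ?_)
  simp only [Matrix.toLin'_apply, Matrix.sub_mulVec, Matrix.mul_neg, Matrix.neg_mul,
    Matrix.neg_mulVec, ← Matrix.mulVec_mulVec, hmul, key]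
  abel

end RepSpaces

end BoundQuiver

namespace BoundQuiver

open CategoryTheory

/-! ### Base change of families -/

section BaseChange

variable {K Λ S T : Type*} [Field K] [Ring Λ] [Algebra K Λ] [CommRing S] [Algebra K S]
  [CommRing T] [Algebra K T]
  {n m p q : Type*} [Fintype n] [DecidableEq n] [Fintype m] [DecidableEq m]
  [Fintype p] [DecidableEq p] [Fintype q] [DecidableEq q]

/-- The base change of a matrix representation. -/
def mapRep (f : S →ₐ[K] T) (σ : Λ →ₐ[K] Matrix n n S) : Λ →ₐ[K] Matrix n n T :=
  f.mapMatrix.comp σ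

@[simp]
theorem mapRep_apply (f : S →ₐ[K] T) (σ : Λ →ₐ[K] Matrix n n S) (x : Λ) :
    mapRep f σ x = (σ x).map f := rfl

theorem map_mul_eq_one (f : S →ₐ[K] T) {H : Matrix n m S} {H' : Matrix m n S} (h : H * H' = 1) :
    H.map f * H'.map f = 1 := by
  rw [← Matrix.map_mul, h, Matrix.map_one _ (map_zero f) (map_one f)]

theorem mapRep_conjRep (f : S →ₐ[K] T) (σ : Λ →ₐ[K] Matrix n n S) (H : Matrix n m S)
    (H' : Matrix m n S) (h : H * H' = 1) (h' : H' * H = 1) :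
    mapRep f (conjRep σ H H' h h') = conjRep (mapRep f σ) (H.map f) (H'.map f)
      (map_mul_eq_one f h) (map_mul_eq_one f h') := by
  ext1 x
  simp [Matrix.map_mul]

theorem conjRep_congr (σ : Λ →ₐ[K] Matrix n n S) {H₁ H₂ : Matrix n m S} {H₁' H₂' : Matrix m n S}
    (h₁ : H₁ * H₁' = 1) (h₁' : H₁' * H₁ = 1) (h₂ : H₂ * H₂' = 1) (h₂' : H₂' * H₂ = 1)
    (e : H₁ = H₂) (e' : H₁' = H₂') : conjRep σ H₁ H₁' h₁ h₁' = conjRep σ H₂ H₂' h₂ h₂' := by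
  subst e e'; rfl

end BaseChange

/-! ### Locally open properties and extensions -/

section LocallyOpen

variable {K Λ : Type u} [Field K] [Ring Λ] [Algebra K Λ]

/-- A property of modules is locally open if in every algebraic family of matrix representations
it holds on a principal open neighbourhood of every parameter for which it holds. -/
def LocallyOpen (K : Type u) [Field K] {Λ : Type u} [Ring Λ] [Algebra K Λ]
    (X : ObjectProperty (ModuleCat.{u} Λ)) : Prop :=
  ∀ (n : Type) [Fintype n] [DecidableEq n] (B : Type u) [CommRing B] [Algebra K B]
    (σ : Λ →ₐ[K] Matrix n n B) (b₀ : B →ₐ[K] K), X (repMod (mapRep b₀ σ)) →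
    ∃ f : B, b₀ f ≠ 0 ∧ ∀ b : B →ₐ[K] K, b f ≠ 0 → X (repMod (mapRep b σ))

variable {n m : Type} [Fintype n] [DecidableEq n] [Fintype m] [DecidableEq m]

/-- The standard basis of the module of a matrix representation. -/
noncomputable def RepSpace.basis (σ : Λ →ₐ[K] Matrix n n K) : Module.Basis n K (RepSpace σ) :=
  Module.Basis.ofEquivFun (RepSpace.vec σ)

/-- The matrix representation on the module of `σ` with respect to the basis `b`. -/
noncomputable def basisRep (σ : Λ →ₐ[K] Matrix n n K) (b : Module.Basis m K (RepSpace σ)) :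
    Λ →ₐ[K] Matrix m m K :=
  conjRep σ ((RepSpace.basis σ).toMatrix b) (b.toMatrix (RepSpace.basis σ))
    ((RepSpace.basis σ).toMatrix_mul_toMatrix_flip b)
    (b.toMatrix_mul_toMatrix_flip (RepSpace.basis σ))

/-- The module of the matrix representation with respect to a basis is the original module. -/
noncomputable def basisRepEquiv (σ : Λ →ₐ[K] Matrix n n K)
    (b : Module.Basis m K (RepSpace σ)) : RepSpace (basisRep σ b) ≃ₗ[Λ] RepSpace σ :=
  conjRepEquiv σ _ _ _ _

theorem vec_basisRepEquiv_symm (σ : Λ →ₐ[K] Matrix n n K) (b : Module.Basis m K (RepSpace σ))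
    (v : RepSpace σ) : RepSpace.vec _ ((basisRepEquiv σ b).symm v) = b.repr v := by
  have : (b.toMatrix (RepSpace.basis σ)).mulVec ((RepSpace.basis σ).repr v) = b.repr v :=
    (RepSpace.basis σ).toMatrix_mulVec_repr b v
  rw [← this]
  rfl

theorem basisRep_apply (σ : Λ →ₐ[K] Matrix n n K) (b : Module.Basis m K (RepSpace σ)) (x : Λ)
    (i j : m) : basisRep σ b x i j = b.repr (x • b j) i := by
  rw [← vec_basisRepEquiv_symm, map_smul, RepSpace.vec_smul, vec_basisRepEquiv_symm,
    Module.Basis.repr_self, Finsupp.single_eq_pi_single, Matrix.mulVec_single_one]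
  rfl

/-- A basis of `U` is completed by lifts of a basis of the quotient; invariance of `U` is the
vanishing of the lower left block. -/
theorem exists_triangular (σ : Λ →ₐ[K] Matrix n n K) (U : Submodule Λ (RepSpace σ)) :
    ∃ (k l : ℕ) (H : Matrix n (Fin k ⊕ Fin l) K) (H' : Matrix (Fin k ⊕ Fin l) n K)
      (h : H * H' = 1) (h' : H' * H = 1)
      (h21 : ∀ x, (conjRep σ H H' h h' x).toBlocks₂₁ = 0),
      Nonempty (U ≃ₗ[Λ] RepSpace (subRep _ h21)) ∧
      Nonempty ((RepSpace σ ⧸ U) ≃ₗ[Λ] RepSpace (quotRep _ h21)) := by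
  let U' : Submodule K (RepSpace σ) := U.restrictScalars K
  let b := (Module.finBasis K U').sumQuot (Module.finBasis K (RepSpace σ ⧸ U'))
  have hmem : ∀ v, v ∈ U ↔ ∀ j, b.repr v (Sum.inr j) = 0 := by
    intro v
    have h1 : v ∈ U ↔ U'.mkQ v = 0 := (Submodule.Quotient.mk_eq_zero U').symm
    rw [h1]
    constructor
    · intro h j
      rw [Module.Basis.sumQuot_repr_inr, h, map_zero]; rfl
    · intro h
      refine (Module.finBasis K (RepSpace σ ⧸ U')).ext_elem fun j => ?_
      rw [← Module.Basis.sumQuot_repr_inr, h, map_zero]; rfl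
  have hvec := vec_basisRepEquiv_symm σ b
  have h21 : ∀ x, (basisRep σ b x).toBlocks₂₁ = 0 := by
    intro x
    ext j i
    have h1 : b.repr (x • b (Sum.inl i)) (Sum.inr j) = 0 := by
      refine (hmem _).1 (U.smul_mem x ((hmem _).2 fun j => ?_)) j
      rw [Module.Basis.repr_self]; simp
    rw [← basisRep_apply] at h1
    exact h1
  let g := quotRepProj _ h21 ∘ₗ (basisRepEquiv σ b).symm.toLinearMap
  let f := (basisRepEquiv σ b).toLinearMap ∘ₗ subRepIncl _ h21
  have hg : LinearMap.ker g = U := by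
    ext v
    rw [hmem, LinearMap.mem_ker]
    constructor
    · intro h j
      have := congrFun h j
      rw [← hvec]; exact this
    · intro h
      funext j
      have := h j
      rw [← hvec] at this; exact this
  have hf : LinearMap.range f = U := by
    rw [← hg]
    ext v
    have := subRepIncl_quotRepProj_exact _ h21 ((basisRepEquiv σ b).symm v)
    rw [LinearMap.mem_ker]
    refine Iff.trans ?_ this.symm
    constructor
    · rintro ⟨w, rfl⟩; exact ⟨w, by simp [f]⟩
    · rintro ⟨w, hw⟩; exact ⟨w, by simp [f, hw]⟩
  have hfi : Function.Injective f :=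
    (basisRepEquiv σ b).injective.comp (subRepIncl_injective _ h21)
  have hgs : Function.Surjective g :=
    (quotRepProj_surjective _ h21).comp (basisRepEquiv σ b).symm.surjective
  exact ⟨_, _, _, _, _, _, h21,
    ⟨((LinearEquiv.ofInjective f hfi).trans (LinearEquiv.ofEq _ _ hf)).symm⟩,
    ⟨(Submodule.quotEquivOfEq _ _ hg.symm).trans (g.quotKerEquivOfSurjective hgs)⟩⟩

/-- Since `Ext¹` from submodule to quotient vanishes, the submodule deforms to nearby members of the
family. The deformed submodules and quotients form families themselves, to which the openness of `X`
and `Z` applies. -/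
theorem LocallyOpen.extensionProperty [IsAlgClosed K] [FiniteDimensional K Λ]
    {X Z : ObjectProperty (ModuleCat.{u} Λ)} [X.IsClosedUnderIsomorphisms]
    [Z.IsClosedUnderIsomorphisms] (hX : LocallyOpen K X) (hZ : LocallyOpen K Z)
    (hExt : ∀ A B : ModuleCat.{u} Λ, X A → Z B → Subsingleton (Abelian.Ext.{u} A B 1)) :
    LocallyOpen K (ExtensionProperty X Z) := by
  intro n _ _ B _ _ σ b₀ hU
  obtain ⟨U, hXU, hZU⟩ := hU
  obtain ⟨k, l, H, H', h, h', h21, ⟨eU⟩, ⟨eQ⟩⟩ := exists_triangular _ U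
  have hXs := prop_of_linearEquiv eU hXU
  have hZq := prop_of_linearEquiv eQ hZU
  let HB := H.map (Algebra.ofId K B)
  let HB' := H'.map (Algebra.ofId K B)
  -- The basis adapted to `U` at `b₀` is used as a constant base change over all of `B`.
  let σ' := conjRep σ HB HB' (map_mul_eq_one _ h) (map_mul_eq_one _ h')
  have hσ' : ∀ b : B →ₐ[K] K, mapRep b σ' = conjRep (mapRep b σ) H H' h h' := by
    intro b
    rw [mapRep_conjRep]
    refine conjRep_congr _ _ _ _ _ ?_ ?_ <;> ext i j <;> simp [HB, HB', Algebra.ofId_apply]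
  have := hExt _ _ hXs hZq
  obtain ⟨r, φ, β₀, hβ₀, hφ, hlift⟩ := exists_graph_lifting σ' b₀
    (fun x => by rw [← mapRep_apply, hσ']; exact h21 x) (fun δ hδ => by
      obtain ⟨u, hu⟩ := exists_inner_of_subsingleton_ext (subRep _ h21) (quotRep _ h21) δ (fun x y => by
        rw [hδ, ← mapRep_apply, ← mapRep_apply, hσ']; rfl)
      refine ⟨u, fun x => ?_⟩
      rw [hu, ← mapRep_apply, hσ']; rfl)
  let R := MvPolynomial (Fin r) B
  let τ : Λ →ₐ[K] Matrix _ _ R := mapRep (IsScalarTower.toAlgHom K B R) σ'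
  have hτ : ∀ (a : B →ₐ[K] K) (β : R →ₐ[K] K), (∀ x, β (MvPolynomial.C x) = a x) →
      mapRep β τ = mapRep a σ' := by
    intro a β h
    ext x i j
    exact h _
  let ρ := shearRep τ φ
  -- `R ⧸ I` parametrizes the invariant graphs in the slice; over it the sheared family is block
  -- triangular, with a subfamily and a quotient family.
  let I : Ideal R := Ideal.span {y | ∃ x i j, y = (ρ x).toBlocks₂₁ i j}
  let π : R →ₐ[K] R ⧸ I := Ideal.Quotient.mkₐ K I
  have hρ21 : ∀ x, (mapRep π ρ x).toBlocks₂₁ = 0 := by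
    intro x
    ext i j
    exact Ideal.Quotient.eq_zero_iff_mem.2 (Ideal.subset_span ⟨x, i, j, rfl⟩)
  have hfac : ∀ β : R →ₐ[K] K, (∀ x, ((ρ x).map β).toBlocks₂₁ = 0) →
      ∃ γ : (R ⧸ I) →ₐ[K] K, γ.comp π = β := by
    intro β hβ
    refine ⟨Ideal.Quotient.liftₐ I β fun y hy => ?_, ?_⟩
    · have : I ≤ RingHom.ker β := by
        rw [Ideal.span_le]
        rintro _ ⟨x, i, j, rfl⟩
        exact congrFun (congrFun (hβ x) i) j
      exact this hy
    · exact AlgHom.ext fun y => rfl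
  have hmapρ : ∀ (β : R →ₐ[K] K) (γ : (R ⧸ I) →ₐ[K] K), γ.comp π = β →
      mapRep γ (mapRep π ρ) = mapRep β ρ := by
    rintro _ γ rfl; rfl
  have hβ₀ρ : mapRep β₀ ρ = mapRep b₀ σ' := by
    rw [← hτ b₀ β₀ hβ₀]
    ext1 x
    have hg : (graphMatrix φ).map β₀ = 1 := by
      rw [graphMatrix, Matrix.fromBlocks_map, hφ]; simp
    have hg' : (graphMatrix (-φ)).map β₀ = 1 := by
      rw [graphMatrix, Matrix.fromBlocks_map, Matrix.map_neg _ (map_neg β₀), hφ]; simp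
    change (graphMatrix (-φ) * τ x * graphMatrix φ).map β₀ = _
    rw [Matrix.map_mul, Matrix.map_mul, hg, hg', Matrix.one_mul, Matrix.mul_one]
    rfl
  obtain ⟨γ₀, hγ₀⟩ := hfac β₀ (fun x => by
    rw [← mapRep_apply, hβ₀ρ, hσ']; exact h21 x)
  have hγ₀ρ := (hmapρ β₀ γ₀ hγ₀).trans (hβ₀ρ.trans (hσ' b₀))
  obtain ⟨fX, hfX, hX'⟩ := hX _ _ (subRep _ hρ21) γ₀ (by
    convert hXs using 2
    ext1 x
    exact congrArg Matrix.toBlocks₁₁ (DFunLike.congr_fun hγ₀ρ x))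
  obtain ⟨fZ, hfZ, hZ'⟩ := hZ _ _ (quotRep _ hρ21) γ₀ (by
    convert hZq using 2
    ext1 x
    exact congrArg Matrix.toBlocks₂₂ (DFunLike.congr_fun hγ₀ρ x))
  obtain ⟨gX, rfl⟩ := Ideal.Quotient.mk_surjective fX
  obtain ⟨gZ, rfl⟩ := Ideal.Quotient.mk_surjective fZ
  have hval : ∀ (β : R →ₐ[K] K) (γ : (R ⧸ I) →ₐ[K] K), γ.comp π = β → ∀ y : R,
      γ (Ideal.Quotient.mk I y) = β y := by
    rintro _ γ rfl y; rfl
  rw [hval β₀ γ₀ hγ₀] at hfX hfZ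
  -- Lifts on which `gX` and `gZ` are nonzero have their submodule in `X` and their quotient in `Z`.
  obtain ⟨f, hf, hfa⟩ := hlift (gX * gZ) (by rw [map_mul]; exact mul_ne_zero hfX hfZ)
  refine ⟨f, hf, fun a ha => ?_⟩
  obtain ⟨β, hβ, hβρ, hβg⟩ := hfa a ha
  rw [map_mul] at hβg
  obtain ⟨γ, hγ⟩ := hfac β hβρ
  have h1 := hX' γ (by rw [hval β γ hγ]; exact left_ne_zero_of_mul hβg)
  have h2 := hZ' γ (by rw [hval β γ hγ]; exact right_ne_zero_of_mul hβg)
  have h3 := extensionProperty_repMod (mapRep γ (mapRep π ρ))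
    (fun x => by rw [hmapρ β γ hγ]; exact hβρ x) h1 h2
  rw [hmapρ β γ hγ] at h3
  have h4 : mapRep β ρ = conjRep (mapRep β τ) _ _ _ _ := mapRep_conjRep β τ _ _ _ _
  rw [h4] at h3
  have h5 := prop_of_linearEquiv (conjRepEquiv _ _ _ _ _) h3
  rw [hτ a β hβ, hσ'] at h5
  exact prop_of_linearEquiv (conjRepEquiv _ _ _ _ _) h5

end LocallyOpen

end BoundQuiver

namespace BoundQuiver

open CategoryTheory

/-! ### Generators of the path algebra -/

section PathAlgebraInduction

variable {K : Type u} [Field K] {Q : Type} [Quiver.{0} Q] [Fintype Q] [DecidableEq Q]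

/-- The trivial path at a vertex, as an element of the path algebra. -/
noncomputable def vertexElt (K : Type u) [Field K] {Q : Type} [Quiver.{0} Q] (i : Q) :
    PathAlgebra K Q :=
  PathAlgebra.ofPath K ⟨i, i, Quiver.Path.nil⟩

/-- An arrow, as an element of the path algebra. -/
noncomputable def arrowElt (K : Type u) [Field K] {Q : Type} [Quiver.{0} Q] (a : Arrow Q) :
    PathAlgebra K Q :=
  PathAlgebra.ofPath K ⟨a.src, a.tgt, a.hom.toPath⟩

theorem subalgebra_eq_top (S : Subalgebra K (PathAlgebra K Q)) (hv : ∀ i, vertexElt K i ∈ S)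
    (ha : ∀ a, arrowElt K a ∈ S) : S = ⊤ := by
  have hp : ∀ p : QPath Q, PathAlgebra.ofPath K p ∈ S := by
    rintro ⟨i, j, p⟩
    induction p with
    | nil => exact hv i
    | @cons j k p a ih =>
      have := mul_mem (ha ⟨j, k, a⟩) ih
      rw [arrowElt, PathAlgebra.ofPath_mul_ofPath, PathAlgebra.pathMul_of_eq] at this
      exact this
  have h : Submodule.mkQ (Subalgebra.toSubmodule S) = 0 := by
    refine PathAlgebra.hom_ext fun p => ?_
    exact (Submodule.Quotient.mk_eq_zero _).2 (hp p)
  rw [eq_top_iff]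
  rintro x -
  exact (Submodule.Quotient.mk_eq_zero (Subalgebra.toSubmodule S)).1 (LinearMap.congr_fun h x)

theorem pathAlgebra_algHom_ext {S : Type*} [Ring S] [Algebra K S]
    {f g : PathAlgebra K Q →ₐ[K] S} (hv : ∀ i, f (vertexElt K i) = g (vertexElt K i))
    (ha : ∀ a, f (arrowElt K a) = g (arrowElt K a)) : f = g := by
  have := subalgebra_eq_top (AlgHom.equalizer f g) hv ha
  ext1 x
  have hx : x ∈ AlgHom.equalizer f g := by rw [this]; trivial
  exact hx

theorem vertexElt_mul_self (i : Q) : vertexElt K i * vertexElt K i = vertexElt K i := by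
  rw [vertexElt, PathAlgebra.ofPath_mul_ofPath, PathAlgebra.pathMul_of_eq]; rfl

theorem vertexElt_mul_of_ne {i j : Q} (h : i ≠ j) : vertexElt K i * vertexElt K j = 0 := by
  rw [vertexElt, vertexElt, PathAlgebra.ofPath_mul_ofPath,
    PathAlgebra.pathMul_of_ne (by exact h.symm)]

theorem sum_vertexElt : ∑ i, vertexElt K (Q := Q) i = 1 := rfl

theorem vertexElt_mul_arrowElt_mul (a : Arrow Q) :
    vertexElt K a.tgt * arrowElt K a * vertexElt K a.src = arrowElt K a := by
  rw [vertexElt, vertexElt, arrowElt, PathAlgebra.ofPath_mul_ofPath, PathAlgebra.pathMul_of_eq,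
    Quiver.Path.comp_nil, PathAlgebra.ofPath_mul_ofPath, PathAlgebra.pathMul_of_eq,
    Quiver.Path.nil_comp]

end PathAlgebraInduction

/-! ### Graded matrix representations and points of `R_d(Λ)` -/

section GradedRepresentations

variable {K : Type u} [Field K] {Q : Type} [Quiver.{0} Q] [Fintype Q] [DecidableEq Q]
  {d : Q → ℕ}

/-- The index set of the standard basis of the total space. -/
abbrev TotalIndex (d : Q → ℕ) : Type := Σ i : Q, Fin (d i)

/-- The standard basis of the total space. -/
noncomputable def totalBasis (K : Type u) [Field K] (d : Q → ℕ) :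
    Module.Basis (TotalIndex d) K (TotalSpace K d) :=
  Pi.basis fun i => Pi.basisFun K (Fin (d i))

theorem totalBasis_repr (v : TotalSpace K d) (x : TotalIndex d) :
    (totalBasis K d).repr v x = v x.1 x.2 := by
  simp [totalBasis, Pi.basis_repr]

theorem totalBasis_apply (x : TotalIndex d) :
    totalBasis K d x = Pi.single x.1 (Pi.single x.2 1) := by
  obtain ⟨i, k⟩ := x
  simp [totalBasis, Pi.basis_apply]

/-- The idempotent diagonal matrix of a vertex. -/
def vertexMatrix (S : Type*) [CommRing S] (d : Q → ℕ) (i : Q) :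
    Matrix (TotalIndex d) (TotalIndex d) S :=
  Matrix.diagonal fun x => if x.1 = i then 1 else 0

/-- The matrices by which the path algebra acts on the total space of a representation. -/
noncomputable def Rep.matrixAction (M : Rep K d) :
    PathAlgebra K Q →ₐ[K] Matrix (TotalIndex d) (TotalIndex d) K :=
  (LinearMap.toMatrixAlgEquiv (totalBasis K d)).toAlgHom.comp M.action

theorem Rep.matrixAction_ofPath (M : Rep K d) (p : QPath Q) (x y : TotalIndex d) :
    M.matrixAction (PathAlgebra.ofPath K p) x y = (Pi.single p.tgt ((M.pathMatrix p.path).mulVec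
      ((Pi.single y.1 (Pi.single y.2 1) : TotalSpace K d) p.src)) : TotalSpace K d) x.1 x.2 := by
  change LinearMap.toMatrixAlgEquiv (totalBasis K d)
    (PathAlgebra.lift M.pathEnd (PathAlgebra.ofPath K p)) x y = _
  rw [LinearMap.toMatrixAlgEquiv_apply, totalBasis_repr, PathAlgebra.lift_ofPath,
    Rep.pathEnd_apply, totalBasis_apply]

theorem Rep.matrixAction_vertexElt (M : Rep K d) (i : Q) :
    M.matrixAction (vertexElt K i) = vertexMatrix K d i := by
  ext x y
  rw [vertexElt, Rep.matrixAction_ofPath]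
  obtain ⟨j, k⟩ := x
  obtain ⟨j', k'⟩ := y
  simp only [Rep.pathMatrix, Matrix.one_mulVec, vertexMatrix, Matrix.diagonal_apply]
  by_cases hj : j = i
  · subst hj
    rw [Pi.single_eq_same]
    by_cases hj' : j' = j
    · subst hj'
      rw [Pi.single_eq_same, Pi.single_apply]
      simp
    · rw [Pi.single_eq_of_ne (Ne.symm hj')]
      simp [Ne.symm hj']
  · rw [Pi.single_eq_of_ne hj]
    simp [hj]

theorem Rep.matrixAction_arrowElt (M : Rep K d) (a : Arrow Q) (k : Fin (d a.tgt))
    (l : Fin (d a.src)) : M.matrixAction (arrowElt K a) ⟨a.tgt, k⟩ ⟨a.src, l⟩ = M a k l := by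
  rw [arrowElt, Rep.matrixAction_ofPath]
  obtain ⟨i, j, a⟩ := a
  simp [Quiver.Hom.toPath, Rep.pathMatrix]

theorem vertexMatrix_mul_mul_apply {S : Type*} [CommRing S]
    (N : Matrix (TotalIndex d) (TotalIndex d) S) (i j : Q) (x y : TotalIndex d) :
    (vertexMatrix S d j * N * vertexMatrix S d i) x y =
      if x.1 = j ∧ y.1 = i then N x y else 0 := by
  rw [vertexMatrix, vertexMatrix, Matrix.mul_diagonal, Matrix.diagonal_mul]
  split_ifs <;> simp_all

theorem eq_of_vertexMatrix_mul_mul {S : Type*} [CommRing S]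
    {N N' : Matrix (TotalIndex d) (TotalIndex d) S} {i j : Q}
    (h : vertexMatrix S d j * N * vertexMatrix S d i = N)
    (h' : vertexMatrix S d j * N' * vertexMatrix S d i = N')
    (hN : ∀ k l, N ⟨j, k⟩ ⟨i, l⟩ = N' ⟨j, k⟩ ⟨i, l⟩) : N = N' := by
  ext x y
  rw [← h, ← h', vertexMatrix_mul_mul_apply, vertexMatrix_mul_mul_apply]
  obtain ⟨j', k⟩ := x
  obtain ⟨i', l⟩ := y
  split_ifs with hxy
  · obtain ⟨rfl, rfl⟩ := hxy
    exact hN k l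
  · rfl

theorem vertexMatrix_mul_arrow {S : Type*} [CommRing S] [Algebra K S]
    (f : PathAlgebra K Q →ₐ[K] Matrix (TotalIndex d) (TotalIndex d) S)
    (hf : ∀ i, f (vertexElt K i) = vertexMatrix S d i) (a : Arrow Q) :
    vertexMatrix S d a.tgt * f (arrowElt K a) * vertexMatrix S d a.src = f (arrowElt K a) := by
  rw [← hf, ← hf, ← map_mul, ← map_mul, vertexElt_mul_arrowElt_mul]

/-- The representation of the quiver which is given by a graded representation of the path
algebra. -/
noncomputable def repOfGraded {S : Type u} [Field S] [Algebra K S]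
    (f : PathAlgebra K Q →ₐ[K] Matrix (TotalIndex d) (TotalIndex d) S) : Rep S d :=
  fun a => Matrix.of fun k l => f (arrowElt K a) ⟨a.tgt, k⟩ ⟨a.src, l⟩

/-- Once the vertices act by coordinate idempotents, an arrow is concentrated in a single block, and
`repOfGraded` records exactly this block. -/
theorem matrixAction_repOfGraded
    (f : PathAlgebra K Q →ₐ[K] Matrix (TotalIndex d) (TotalIndex d) K)
    (hf : ∀ i, f (vertexElt K i) = vertexMatrix K d i) : (repOfGraded f).matrixAction = f := by
  refine pathAlgebra_algHom_ext (fun i => ?_) fun a => ?_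
  · rw [Rep.matrixAction_vertexElt, hf]
  · refine eq_of_vertexMatrix_mul_mul
      (vertexMatrix_mul_arrow _ (Rep.matrixAction_vertexElt _) a) (vertexMatrix_mul_arrow f hf a)
      fun k l => ?_
    rw [Rep.matrixAction_arrowElt]; rfl

variable {Λ : Type u} [Ring Λ] [Algebra K Λ]

/-- The matrix representation of `Λ` which is given by a point of the representation variety. -/
noncomputable def varietyRep (P : Presentation K Q Λ) (M : Rep K d) (hM : M ∈ repVariety P d) :
    Λ →ₐ[K] Matrix (TotalIndex d) (TotalIndex d) K :=
  { (LinearMap.toMatrixAlgEquiv (totalBasis K d)).toAlgHom.toRingHom.comp (repAction P M hM) with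
    commutes' := fun c => by
      change LinearMap.toMatrixAlgEquiv (totalBasis K d) (repAction P M hM _) = _
      rw [← P.proj.commutes, repAction_proj, AlgHom.commutes, AlgEquiv.commutes] }

theorem varietyRep_apply (P : Presentation K Q Λ) (M : Rep K d) (hM : M ∈ repVariety P d)
    (x : Λ) : varietyRep P M hM x =
      LinearMap.toMatrixAlgEquiv (totalBasis K d) (repAction P M hM x) := rfl

theorem varietyRep_proj (P : Presentation K Q Λ) (M : Rep K d) (hM : M ∈ repVariety P d)
    (x : PathAlgebra K Q) : varietyRep P M hM (P.proj x) = M.matrixAction x := by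
  rw [varietyRep_apply, repAction_proj]; rfl

/-- The module of a point of the representation variety, in terms of matrices. -/
noncomputable def repModuleEquiv (P : Presentation K Q Λ) (M : Rep K d)
    (hM : M ∈ repVariety P d) : repModule P M hM ≃ₗ[Λ] RepSpace (varietyRep P M hM) :=
  let e : TotalSpace K d ≃ₗ[K] RepSpace (varietyRep P M hM) :=
    (totalBasis K d).equivFun.trans (RepSpace.vec _).symm
  { toFun := fun v => e v
    invFun := fun v => e.symm v
    left_inv := fun v => e.symm_apply_apply v
    right_inv := fun v => e.apply_symm_apply v
    map_add' := fun v w => e.map_add v w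
    map_smul' := fun x v => by
      refine RepSpace.ext ?_
      change (totalBasis K d).repr (repAction P M hM x v) =
        (varietyRep P M hM x).mulVec ((totalBasis K d).repr v)
      exact (LinearMap.toMatrix_mulVec_repr (totalBasis K d) (totalBasis K d) _ v).symm }

theorem mem_repLocus_iff (P : Presentation K Q Λ) (X : ObjectProperty (ModuleCat.{u} Λ))
    [X.IsClosedUnderIsomorphisms] (M : Rep K d) (hM : M ∈ repVariety P d) :
    M ∈ repLocus P X d ↔ X (repMod (varietyRep P M hM)) :=
  ⟨fun ⟨_, h⟩ => X.prop_of_iso (repModuleEquiv P M hM).toModuleIso h,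
    fun h => ⟨hM, X.prop_of_iso (repModuleEquiv P M hM).toModuleIso.symm h⟩⟩

/-- A graded matrix representation of `Λ` is given by a point of the representation variety. -/
theorem exists_varietyRep_eq (P : Presentation K Q Λ)
    (τ : Λ →ₐ[K] Matrix (TotalIndex d) (TotalIndex d) K)
    (hτ : ∀ i, τ (P.proj (vertexElt K i)) = vertexMatrix K d i) :
    ∃ hM : repOfGraded (τ.comp P.proj) ∈ repVariety P d, varietyRep P _ hM = τ := by
  have h := matrixAction_repOfGraded (τ.comp P.proj) hτ
  have hM : repOfGraded (τ.comp P.proj) ∈ repVariety P d := by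
    intro x hx
    refine (LinearMap.toMatrixAlgEquiv (totalBasis K d)).injective ?_
    have h1 := AlgHom.congr_fun h x
    rw [AlgHom.comp_apply, hx, map_zero] at h1
    rw [map_zero]
    exact h1
  refine ⟨hM, AlgHom.ext fun x => ?_⟩
  obtain ⟨x, rfl⟩ := P.surjective x
  rw [varietyRep_proj, h]; rfl

end GradedRepresentations

end BoundQuiver

namespace BoundQuiver

open CategoryTheory

/-! ### Zariski openness and local openness -/

section ZariskiOpen

variable {K : Type u} [Field K] {Q : Type} [Quiver.{0} Q] [Fintype Q] [DecidableEq Q]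
  {Λ : Type u} [Ring Λ] [Algebra K Λ] {d : Q → ℕ}

/-- A family of matrix representations, as a matrix representation over the ring of functions. -/
def familyRep {I n : Type*} [Fintype n] [DecidableEq n] (ρ : I → Λ →ₐ[K] Matrix n n K) :
    Λ →ₐ[K] Matrix n n (I → K) :=
  AlgHom.ofLinearMap
    { toFun := fun x => Matrix.of fun i j t => ρ t x i j
      map_add' := fun x y => by ext i j t; simp
      map_smul' := fun c x => by ext i j t; simp }
    (by
      ext i j t
      simp only [map_one, LinearMap.coe_mk, AddHom.coe_mk, Matrix.of_apply]
      rw [Matrix.one_apply, Matrix.one_apply]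
      split_ifs <;> rfl)
    (fun x y => by
      ext i j t
      simp [Matrix.mul_apply])

/-- The polynomial functions on the representation variety. -/
noncomputable def evalHom (P : Presentation K Q Λ) (d : Q → ℕ) :
    MvPolynomial (Coord d) K →ₐ[K] (repVariety P d → K) :=
  AlgHom.pi fun M => MvPolynomial.aeval M.1.coords

theorem evalHom_apply (P : Presentation K Q Λ) (f : MvPolynomial (Coord d) K)
    (M : repVariety P d) : evalHom P d f M = MvPolynomial.eval M.1.coords f := by
  rw [← MvPolynomial.coe_aeval_eq_eval]; rfl

/-- The entries of the universal representation are polynomial functions: this is clear for vertices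
(constants) and arrows (coordinates), and these generate. -/
theorem familyRep_mem_range (P : Presentation K Q Λ) (d : Q → ℕ) (x : Λ) :
    familyRep (fun M : repVariety P d => varietyRep P M.1 M.2) x ∈
      ((evalHom P d).range.val.mapMatrix (m := TotalIndex d)).range := by
  let Φ := (familyRep (fun M : repVariety P d => varietyRep P M.1 M.2)).comp P.proj
  have hmem : ∀ N : Matrix (TotalIndex d) (TotalIndex d) (repVariety P d → K),
      (∀ i j, N i j ∈ (evalHom P d).range) →
      N ∈ ((evalHom P d).range.val.mapMatrix (m := TotalIndex d)).range := fun N h =>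
    ⟨Matrix.of fun i j => ⟨N i j, h i j⟩, rfl⟩
  have hv : ∀ i, Φ (vertexElt K i) = vertexMatrix _ d i := by
    intro i
    ext x y t
    change varietyRep P t.1 t.2 (P.proj (vertexElt K i)) x y = _
    rw [varietyRep_proj, Rep.matrixAction_vertexElt, vertexMatrix, vertexMatrix,
      Matrix.diagonal_apply, Matrix.diagonal_apply]
    split_ifs <;> rfl
  have h : (((evalHom P d).range.val.mapMatrix (m := TotalIndex d)).range.comap Φ) = ⊤ := by
    refine subalgebra_eq_top _ (fun i => ?_) fun a => ?_
    · refine hmem (Φ (vertexElt K i)) fun x y => ?_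
      rw [hv, vertexMatrix, Matrix.diagonal_apply]
      split_ifs
      · exact one_mem _
      · exact zero_mem _
      · exact zero_mem _
    · refine hmem (Φ (arrowElt K a)) fun x y => ?_
      rw [← vertexMatrix_mul_arrow Φ hv a, vertexMatrix_mul_mul_apply]
      split_ifs with hxy
      · obtain ⟨i, k⟩ := x
        obtain ⟨j, l⟩ := y
        obtain ⟨rfl, rfl⟩ := hxy
        refine ⟨MvPolynomial.X ⟨a, k, l⟩, ?_⟩
        funext t
        change evalHom P d _ t = varietyRep P t.1 t.2 (P.proj (arrowElt K a)) _ _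
        rw [evalHom_apply, MvPolynomial.eval_X, varietyRep_proj, Rep.matrixAction_arrowElt]
        rfl
      · exact zero_mem _
  obtain ⟨x, rfl⟩ := P.surjective x
  have hx : x ∈ (((evalHom P d).range.val.mapMatrix (m := TotalIndex d)).range.comap Φ) := by
    rw [h]; trivial
  exact hx

/-- The loci of a locally open property are Zariski open. -/
theorem LocallyOpen.isZariskiOpenIn (P : Presentation K Q Λ)
    {X : ObjectProperty (ModuleCat.{u} Λ)} [X.IsClosedUnderIsomorphisms] (hX : LocallyOpen K X)
    (d : Q → ℕ) : IsZariskiOpenIn (repVariety P d) (repLocus P X d) := by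
  -- The largest possible set of polynomials is taken; only the existence of one that is nonzero at
  -- `M` has to be shown.
  refine ⟨fun M hM => hM.1, {f | ∀ M ∈ repVariety P d, MvPolynomial.eval M.coords f ≠ 0 →
    M ∈ repLocus P X d}, fun M hM => ⟨fun h => ?_, fun ⟨f, hf, hfM⟩ => hf M hM hfM⟩⟩
  rw [mem_repLocus_iff P X M hM] at h
  let B := (evalHom P d).range
  have hinj : Function.Injective (B.val.mapMatrix (m := TotalIndex d)) := by
    intro N N' hN
    ext1 i j
    exact Subtype.ext (congrFun (congrFun hN i) j)
  -- The universal family over the coordinate ring `B` of `R_d(Λ)`; its fibre at the evaluation `ev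
  -- M` is the module of `M`.
  let σ : Λ →ₐ[K] Matrix (TotalIndex d) (TotalIndex d) B :=
    ((AlgEquiv.ofInjective _ hinj).symm : _ →ₐ[K] _).comp
      ((familyRep fun M : repVariety P d => varietyRep P M.1 M.2).codRestrict _
        (familyRep_mem_range P d))
  have hσ : ∀ x, (σ x).map B.val =
      familyRep (fun M : repVariety P d => varietyRep P M.1 M.2) x := by
    intro x
    exact congrArg Subtype.val ((AlgEquiv.ofInjective _ hinj).apply_symm_apply
      ((familyRep fun M : repVariety P d => varietyRep P M.1 M.2).codRestrict _
        (familyRep_mem_range P d) x))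
  let ev : repVariety P d → B →ₐ[K] K := fun M => (Pi.evalAlgHom K (fun _ => K) M).comp B.val
  have hev : ∀ M, mapRep (ev M) σ = varietyRep P M.1 M.2 := by
    intro M
    ext x i j
    have := congrFun (congrFun (congrFun (hσ x) i) j) M
    exact this
  obtain ⟨⟨_, f, rfl⟩, hf, hfX⟩ := hX (TotalIndex d) B σ (ev ⟨M, hM⟩) (by rwa [hev])
  have hevf : ∀ M, ev M ⟨evalHom P d f, f, rfl⟩ = MvPolynomial.eval M.1.coords f :=
    fun M => evalHom_apply P f M
  refine ⟨f, fun N hN hfN => ?_, (hevf ⟨M, hM⟩).symm.trans_ne hf⟩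
  rw [mem_repLocus_iff P X N hN]
  have := hfX (ev ⟨N, hN⟩) ((hevf ⟨N, hN⟩).trans_ne hfN)
  rwa [hev] at this

/-- A basis of a module which is adapted to the decomposition by the vertices. -/
theorem exists_vertex_basis (P : Presentation K Q Λ) {n : Type} [Fintype n] [DecidableEq n]
    (σ : Λ →ₐ[K] Matrix n n K) : ∃ (d : Q → ℕ) (b : Module.Basis (TotalIndex d) K (RepSpace σ)),
      ∀ i x, P.proj (vertexElt K i) • b x = if x.1 = i then b x else 0 := by
  let e : Q → RepSpace σ →ₗ[K] RepSpace σ := fun i =>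
    Algebra.lsmul K K (RepSpace σ) (P.proj (vertexElt K i))
  have he : ∀ i v, e i v = P.proj (vertexElt K i) • v := fun i v => rfl
  have hii : ∀ i v, e i (e i v) = e i v := fun i v => by
    rw [he, he, smul_smul, ← map_mul, vertexElt_mul_self]
  have hij : ∀ i j, i ≠ j → ∀ v, e i (e j v) = 0 := fun i j h v => by
    rw [he, he, smul_smul, ← map_mul, vertexElt_mul_of_ne h, map_zero, zero_smul]
  have hsum : ∀ v, ∑ i, e i v = v := fun v => by
    simp only [he]
    rw [← Finset.sum_smul, ← map_sum, sum_vertexElt, map_one, one_smul]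
  have hmem : ∀ i (v : LinearMap.range (e i)), e i v = v := by
    rintro i ⟨_, v, rfl⟩
    exact hii i v
  have hmem' : ∀ i j (v : LinearMap.range (e j)), i ≠ j → e i v = 0 := by
    rintro i j ⟨_, v, rfl⟩ h
    exact hij i j h v
  -- The decomposition given by the orthogonal idempotents `e i` with sum `1`.
  let E : RepSpace σ ≃ₗ[K] (∀ i, LinearMap.range (e i)) :=
    { toFun := fun v i => ⟨e i v, v, rfl⟩
      invFun := fun w => ∑ i, (w i : RepSpace σ)
      left_inv := fun v => hsum v
      right_inv := fun w => by
        funext i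
        refine Subtype.ext ?_
        change e i (∑ j, (w j : RepSpace σ)) = w i
        rw [map_sum, Finset.sum_eq_single i (fun j _ hj => hmem' i j (w j) hj.symm)
          (fun h => absurd (Finset.mem_univ i) h), hmem]
      map_add' := fun v w => by
        funext i; exact Subtype.ext (map_add (e i) v w)
      map_smul' := fun c v => by
        funext i; exact Subtype.ext (map_smul (e i) c v) }
  let s := fun i => Module.finBasis K (LinearMap.range (e i))
  refine ⟨fun i => Module.finrank K (LinearMap.range (e i)), (Pi.basis s).map E.symm, ?_⟩
  rintro i ⟨j, k⟩
  have hb : ((Pi.basis s).map E.symm) ⟨j, k⟩ = (s j k : RepSpace σ) := by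
    rw [Module.Basis.map_apply, Pi.basis_apply]
    change ∑ i, ((Pi.single j (s j k) : ∀ i, LinearMap.range (e i)) i : RepSpace σ) = _
    rw [Finset.sum_eq_single j]
    · rw [Pi.single_eq_same]
    · intro i _ hi
      rw [Pi.single_eq_of_ne hi]; rfl
    · intro h
      exact absurd (Finset.mem_univ j) h
  rw [hb, ← he]
  split_ifs with h
  · subst h
    exact hmem _ _
  · exact hmem' _ _ _ (Ne.symm h)

/-- Properties with Zariski open loci are locally open. -/
theorem locallyOpen_of_isZariskiOpenIn (P : Presentation K Q Λ)
    {X : ObjectProperty (ModuleCat.{u} Λ)} [X.IsClosedUnderIsomorphisms]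
    (hX : ∀ d : Q → ℕ, IsZariskiOpenIn (repVariety P d) (repLocus P X d)) : LocallyOpen K X := by
  intro n _ _ B _ _ σ b₀ hσ
  obtain ⟨d, bas, hbas⟩ := exists_vertex_basis P (mapRep b₀ σ)
  obtain ⟨-, S, hS⟩ := hX d
  let H := (RepSpace.basis (mapRep b₀ σ)).toMatrix bas
  let H' := bas.toMatrix (RepSpace.basis (mapRep b₀ σ))
  have h : H * H' = 1 := (RepSpace.basis _).toMatrix_mul_toMatrix_flip bas
  have h' : H' * H = 1 := bas.toMatrix_mul_toMatrix_flip _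
  let σ' := conjRep σ (H.map (Algebra.ofId K B)) (H'.map (Algebra.ofId K B))
    (map_mul_eq_one _ h) (map_mul_eq_one _ h')
  have hσ' : ∀ b : B →ₐ[K] K, mapRep b σ' = conjRep (mapRep b σ) H H' h h' := by
    intro b
    rw [mapRep_conjRep]
    refine conjRep_congr _ _ _ _ _ ?_ ?_ <;> ext i j <;> simp [Algebra.ofId_apply]
  let ε : Q → Λ := fun i => P.proj (vertexElt K i)
  have hε₀ : ∀ i, mapRep b₀ σ' (ε i) = vertexMatrix K d i := by
    intro i
    rw [hσ']
    ext x y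
    change basisRep (mapRep b₀ σ) bas (ε i) x y = _
    rw [basisRep_apply, hbas, vertexMatrix, Matrix.diagonal_apply]
    split_ifs with h1 h2 h2 <;> simp_all
  have hεmul : ∀ (C : Type u) [CommRing C] (i j : Q),
      vertexMatrix C d i * vertexMatrix C d j = if i = j then vertexMatrix C d i else 0 := by
    intro C _ i j
    rw [vertexMatrix, vertexMatrix, Matrix.diagonal_mul_diagonal]
    split_ifs with h
    · subst h
      congr 1
      funext x
      split_ifs <;> simp
    · rw [← Matrix.diagonal_zero]
      congr 1
      funext x
      split_ifs <;> simp_all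
  have hεsum : ∀ (C : Type u) [CommRing C], ∑ i, vertexMatrix C d i = 1 := by
    intro C _
    ext x y
    rw [Matrix.sum_apply]
    simp only [vertexMatrix, Matrix.diagonal_apply, Matrix.one_apply]
    split_ifs <;> simp
  -- `Γ` intertwines the idempotents of the family with the constant ones and is the identity at
  -- `b₀`, so it is invertible after inverting its determinant `δ`.
  let Γ : Matrix (TotalIndex d) (TotalIndex d) B := ∑ i, σ' (ε i) * vertexMatrix B d i
  have hΓ : ∀ i, σ' (ε i) * Γ = Γ * vertexMatrix B d i := by
    intro i
    simp only [Γ, Finset.mul_sum, Finset.sum_mul]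
    rw [Finset.sum_eq_single i, Finset.sum_eq_single i]
    · rw [← Matrix.mul_assoc, ← map_mul, ← map_mul, vertexElt_mul_self, Matrix.mul_assoc,
        hεmul, if_pos rfl]
    · intro j _ hj
      rw [Matrix.mul_assoc, hεmul, if_neg hj, Matrix.mul_zero]
    · simp
    · intro j _ hj
      rw [← Matrix.mul_assoc, ← map_mul, ← map_mul, vertexElt_mul_of_ne (Ne.symm hj), map_zero,
        map_zero, Matrix.zero_mul]
    · simp
  have hΓ₀ : Γ.map b₀ = 1 := by
    rw [← hεsum K]
    change b₀.mapMatrix Γ = _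
    rw [map_sum]
    refine Finset.sum_congr rfl fun i _ => ?_
    rw [map_mul]
    have h1 : b₀.mapMatrix (σ' (ε i)) = vertexMatrix K d i := hε₀ i
    have h2 : b₀.mapMatrix (vertexMatrix B d i) = vertexMatrix K d i := by
      ext x y
      simp [vertexMatrix, Matrix.diagonal_apply, apply_ite b₀]
    rw [h1, h2, hεmul, if_pos rfl]
  let δ := Γ.det
  have hδ₀ : b₀ δ = 1 := by
    have : b₀ δ = (Γ.map b₀).det := AlgHom.map_det b₀ Γ
    rw [this, hΓ₀, Matrix.det_one]
  let T := Localization.Away δ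
  let ι : B →ₐ[K] T := IsScalarTower.toAlgHom K B T
  let Γ' := Γ.map ι
  have hΓ'u : IsUnit Γ'.det := by
    have : ι δ = Γ'.det := AlgHom.map_det ι Γ
    rw [← this]
    exact IsLocalization.Away.algebraMap_isUnit δ
  let ρ := conjRep (mapRep ι σ') Γ' Γ'⁻¹ (Matrix.mul_nonsing_inv _ hΓ'u)
    (Matrix.nonsing_inv_mul _ hΓ'u)
  have hρε : ∀ i, ρ (ε i) = vertexMatrix T d i := by
    intro i
    have h1 := congrArg ι.mapMatrix (hΓ i)
    rw [map_mul, map_mul] at h1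
    have h2 : ι.mapMatrix (vertexMatrix B d i) = vertexMatrix T d i := by
      ext x y
      simp [vertexMatrix, Matrix.diagonal_apply, apply_ite ι]
    rw [h2] at h1
    change Γ'⁻¹ * ι.mapMatrix (σ' (ε i)) * Γ' = _
    rw [Matrix.mul_assoc]
    erw [h1]
    rw [← Matrix.mul_assoc]
    erw [Matrix.nonsing_inv_mul _ hΓ'u]
    rw [Matrix.one_mul]
  -- The arrow blocks of the graded family `ρ` are the coordinates of a map from the points of `T`
  -- to `R_d(Λ)`; the polynomials in `S` are pulled back along it.
  let c : Coord d → T := fun z => ρ (P.proj (arrowElt K z.1)) ⟨z.1.tgt, z.2.1⟩ ⟨z.1.src, z.2.2⟩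
  have key : ∀ t : T →ₐ[K] K, X (repMod (mapRep (t.comp ι) σ)) ↔
      ∃ f ∈ S, t (MvPolynomial.aeval c f) ≠ 0 := by
    intro t
    obtain ⟨hM, hMρ⟩ := exists_varietyRep_eq P (mapRep t ρ) (d := d) (fun i => by
      rw [mapRep_apply]
      erw [hρε]
      ext x y
      simp [vertexMatrix, Matrix.diagonal_apply, apply_ite t])
    have h1 : X (repMod (mapRep (t.comp ι) σ)) ↔ X (repMod (mapRep t ρ)) := by
      have e1 : mapRep t ρ = conjRep (mapRep (t.comp ι) σ') (Γ'.map t) (Γ'⁻¹.map t) _ _ :=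
        mapRep_conjRep t _ _ _ _ _
      rw [e1, hσ']
      have e2 := (conjRepEquiv _ _ _ (map_mul_eq_one t (Matrix.mul_nonsing_inv _ hΓ'u))
        (map_mul_eq_one t (Matrix.nonsing_inv_mul _ hΓ'u))).trans
        (conjRepEquiv (mapRep (t.comp ι) σ) H H' h h')
      exact ⟨fun hx => prop_of_linearEquiv e2.symm hx, fun hx => prop_of_linearEquiv e2 hx⟩
    rw [h1, ← hMρ, ← mem_repLocus_iff P X _ hM, hS _ hM]
    have h2 : ∀ f, MvPolynomial.eval (repOfGraded ((mapRep t ρ).comp P.proj)).coords f =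
        t (MvPolynomial.aeval c f) := by
      intro f
      rw [← AlgHom.comp_apply, MvPolynomial.comp_aeval, ← MvPolynomial.coe_aeval_eq_eval]
      rfl
    simp only [h2]
  have hext : ∀ b : B →ₐ[K] K, b δ ≠ 0 → ∃ t : T →ₐ[K] K, t.comp ι = b := by
    intro b hb
    let t : T →ₐ[K] K := IsLocalization.liftAlgHom (M := Submonoid.powers δ) (f := b) (by
      rintro ⟨_, n, rfl⟩
      rw [map_pow]
      exact (IsUnit.mk0 _ hb).pow n)
    refine ⟨t, AlgHom.ext fun x => ?_⟩
    exact IsLocalization.lift_eq _ _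
  obtain ⟨t₀, ht₀⟩ := hext b₀ (by rw [hδ₀]; exact one_ne_zero)
  obtain ⟨f, hfS, hf⟩ := (key t₀).1 (by rwa [ht₀])
  -- Denominators are cleared to return from `T` to `B`; the factor `δ` in `δ * y` keeps the points
  -- liftable to `T`.
  obtain ⟨k, y, hy⟩ := IsLocalization.Away.surj δ (MvPolynomial.aeval c f)
  have hy' : ∀ t : T →ₐ[K] K, t (MvPolynomial.aeval c f) * (t.comp ι δ) ^ k = t.comp ι y := by
    intro t
    have := congrArg t hy
    rw [map_mul, map_pow] at this
    exact this
  refine ⟨δ * y, ?_, fun b hb => ?_⟩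
  · rw [map_mul, hδ₀, one_mul, ← ht₀, ← hy', ht₀, hδ₀, one_pow, mul_one]
    exact hf
  · rw [map_mul] at hb
    obtain ⟨t, rfl⟩ := hext b (left_ne_zero_of_mul hb)
    refine (key t).2 ⟨f, hfS, ?_⟩
    have := right_ne_zero_of_mul hb
    rw [← hy'] at this
    exact left_ne_zero_of_mul this

end ZariskiOpen

end BoundQuiver

namespace BoundQuiver

open CategoryTheory

/-! ### Direct sums, summands and degenerations -/

section DirectSums

variable {K Λ : Type u} [Field K] [Ring Λ] [Algebra K Λ]

theorem exists_repSpace_equiv (K : Type u) [Field K] [Algebra K Λ] [FiniteDimensional K Λ]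
    (M : Type u) [AddCommGroup M] [Module Λ M] [Module.Finite Λ M] :
    ∃ (n : ℕ) (σ : Λ →ₐ[K] Matrix (Fin n) (Fin n) K), Nonempty (M ≃ₗ[Λ] RepSpace σ) := by
  let _ : Module K M := Module.compHom M (algebraMap K Λ)
  have : IsScalarTower K Λ M := ⟨fun c x m => by
    change (c • x) • m = algebraMap K Λ c • x • m
    rw [Algebra.smul_def, mul_smul]⟩
  have : FiniteDimensional K M := Module.Finite.trans Λ M
  let b := Module.finBasis K M
  let σ : Λ →ₐ[K] Matrix _ _ K :=
    (LinearMap.toMatrixAlgEquiv b).toAlgHom.comp (Algebra.lsmul K K M)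
  let e : M ≃ₗ[K] RepSpace σ := b.equivFun.trans (RepSpace.vec σ).symm
  refine ⟨_, σ, ⟨{ e with map_smul' := fun x v => RepSpace.ext ?_ }⟩⟩
  exact (LinearMap.toMatrix_mulVec_repr b b (Algebra.lsmul K K M x) v).symm

/-- The direct sum of two matrix representations. -/
def sumRep {S : Type*} [CommRing S] [Algebra K S] {p q : Type*} [Fintype p] [DecidableEq p]
    [Fintype q] [DecidableEq q] (α : Λ →ₐ[K] Matrix p p S) (γ : Λ →ₐ[K] Matrix q q S) :
    Λ →ₐ[K] Matrix (p ⊕ q) (p ⊕ q) S :=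
  AlgHom.ofLinearMap
    { toFun := fun x => Matrix.fromBlocks (α x) 0 0 (γ x)
      map_add' := fun x y => by simp [Matrix.fromBlocks_add]
      map_smul' := fun c x => by simp [Matrix.fromBlocks_smul] }
    (by simp)
    (fun x y => by simp [Matrix.fromBlocks_multiply])

theorem sumRep_apply {S : Type*} [CommRing S] [Algebra K S] {p q : Type*} [Fintype p]
    [DecidableEq p] [Fintype q] [DecidableEq q] (α : Λ →ₐ[K] Matrix p p S)
    (γ : Λ →ₐ[K] Matrix q q S) (x : Λ) :
    sumRep α γ x = Matrix.fromBlocks (α x) 0 0 (γ x) := rfl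

variable {p q : Type} [Fintype p] [DecidableEq p] [Fintype q] [DecidableEq q]

/-- The module of a direct sum of matrix representations is a product. -/
def sumRepEquiv (α : Λ →ₐ[K] Matrix p p K) (γ : Λ →ₐ[K] Matrix q q K) :
    RepSpace (sumRep α γ) ≃ₗ[Λ] RepSpace α × RepSpace γ where
  toFun v := ((RepSpace.vec α).symm (RepSpace.vec _ v ∘ Sum.inl),
    (RepSpace.vec γ).symm (RepSpace.vec _ v ∘ Sum.inr))
  invFun w := (RepSpace.vec _).symm (Sum.elim (RepSpace.vec α w.1) (RepSpace.vec γ w.2))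
  left_inv v := RepSpace.ext (by simp)
  right_inv w := by simp
  map_add' v w := rfl
  map_smul' x v := by
    refine Prod.ext (RepSpace.ext ?_) (RepSpace.ext ?_) <;>
    simp [sumRep_apply, Matrix.fromBlocks_mulVec]

/-- The complement `N` found at `b₀` is added to the whole family as a constant summand. -/
theorem LocallyOpen.of_prod [FiniteDimensional K Λ] {Y : ObjectProperty (ModuleCat.{u} Λ)}
    [Y.IsClosedUnderIsomorphisms] (hY : LocallyOpen K Y) (hfin : ∀ M, Y M → Module.Finite Λ M) :
    LocallyOpen K (fun M : ModuleCat.{u} Λ => ∃ N : ModuleCat.{u} Λ,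
      Y (ModuleCat.of Λ (M × N))) := by
  rintro n _ _ B _ _ σ b₀ ⟨N, hN⟩
  have := hfin _ hN
  have : Module.Finite Λ N := Module.Finite.of_surjective
    (LinearMap.snd Λ (RepSpace (mapRep b₀ σ)) N) LinearMap.snd_surjective
  obtain ⟨m, τ, ⟨e⟩⟩ := exists_repSpace_equiv K N (Λ := Λ)
  have hmap : ∀ b : B →ₐ[K] K, mapRep b (sumRep σ (mapRep (Algebra.ofId K B) τ)) =
      sumRep (mapRep b σ) τ := by
    intro b
    ext1 x
    rw [mapRep_apply, sumRep_apply, sumRep_apply, Matrix.fromBlocks_map]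
    congr 1
    · ext i j; simp
    · ext i j; simp
    · ext i j; simp [Algebra.ofId_apply]
  have equiv : ∀ b : B →ₐ[K] K, (RepSpace (mapRep b σ) × N) ≃ₗ[Λ]
      RepSpace (mapRep b (sumRep σ (mapRep (Algebra.ofId K B) τ))) := by
    intro b
    rw [hmap]
    exact ((LinearEquiv.refl Λ _).prodCongr e).trans (sumRepEquiv _ _).symm
  obtain ⟨f, hf, hfb⟩ := hY _ B (sumRep σ (mapRep (Algebra.ofId K B) τ)) b₀
    (prop_of_linearEquiv (equiv b₀) hN)
  exact ⟨f, hf, fun b hb => ⟨N, prop_of_linearEquiv (equiv b).symm (hfb b hb)⟩⟩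

open Polynomial in
/-- Locally open properties which are closed under direct sums are closed under extensions, since
an extension degenerates to the direct sum. -/
theorem LocallyOpen.extensionProperty_le [Infinite K] [FiniteDimensional K Λ]
    {X : ObjectProperty (ModuleCat.{u} Λ)} [X.IsClosedUnderIsomorphisms] (hX : LocallyOpen K X)
    (hfin : ∀ M, X M → Module.Finite Λ M)
    (hsum : ∀ A B : ModuleCat.{u} Λ, X A → X B → X (ModuleCat.of Λ (A × B))) :
    ExtensionProperty X X ≤ X := by
  intro M hM
  have hMfin : Module.Finite Λ M := by
    obtain ⟨U, hU, hQ⟩ := hM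
    have := hfin _ hU
    have := hfin _ hQ
    exact Module.Finite.of_submodule_quotient U
  obtain ⟨n, σ, ⟨e⟩⟩ := exists_repSpace_equiv K M (Λ := Λ)
  refine prop_of_linearEquiv (N := M) e.symm ?_
  obtain ⟨U, hU, hQ⟩ := (prop_of_linearEquiv e hM : ExtensionProperty X X (repMod σ))
  obtain ⟨k, l, H, H', h, h', h21, ⟨eU⟩, ⟨eQ⟩⟩ := exists_triangular σ U
  refine prop_of_linearEquiv (M := RepSpace (conjRep σ H H' h h'))
    (conjRepEquiv σ H H' h h') ?_
  generalize conjRep σ H H' h h' = τ at *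
  have hα := prop_of_linearEquiv eU hU
  have hγ := prop_of_linearEquiv eQ hQ
  -- The extension class is scaled by the parameter: the fibre at `0` is the direct sum, and every
  -- other fibre is isomorphic to the given module.
  let ρ : Λ →ₐ[K] Matrix (Fin k ⊕ Fin l) (Fin k ⊕ Fin l) K[X] := AlgHom.ofLinearMap
    { toFun := fun x => Matrix.fromBlocks ((subRep τ h21 x).map C)
        ((Polynomial.X : K[X]) • (τ x).toBlocks₁₂.map C) 0 ((quotRep τ h21 x).map C)
      map_add' := fun x y => by
        rw [map_add, map_add, map_add, Matrix.fromBlocks_add, ← Matrix.map_add _ (map_add C),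
          ← Matrix.map_add _ (map_add C), add_zero, ← smul_add, ← Matrix.map_add _ (map_add C)]
        rfl
      map_smul' := fun c x => by
        rw [map_smul, map_smul, map_smul, RingHom.id_apply, Matrix.fromBlocks_smul]
        congr 1 <;> ext1 i j <;>
        simp [Matrix.toBlocks₁₂, Polynomial.smul_eq_C_mul]
        ring }
    (by
      have h12 : (τ 1).toBlocks₁₂ = 0 := by
        rw [map_one, ← Matrix.fromBlocks_one, Matrix.toBlocks_fromBlocks₁₂]
      simp only [LinearMap.coe_mk, AddHom.coe_mk]
      rw [h12, map_one, map_one, Matrix.map_one _ (map_zero C) (map_one C),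
        Matrix.map_one _ (map_zero C) (map_one C), Matrix.map_zero _ (map_zero C), smul_zero,
        Matrix.fromBlocks_one])
    (fun x y => by
      have h12 : (τ (x * y)).toBlocks₁₂ = subRep τ h21 x * (τ y).toBlocks₁₂ +
          (τ x).toBlocks₁₂ * quotRep τ h21 y := by
        rw [map_mul, subRep_apply, quotRep_apply]
        conv_lhs => rw [← Matrix.fromBlocks_toBlocks (τ x), ← Matrix.fromBlocks_toBlocks (τ y),
          Matrix.fromBlocks_multiply, Matrix.toBlocks_fromBlocks₁₂]
      simp only [LinearMap.coe_mk, AddHom.coe_mk]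
      rw [h12, map_mul, map_mul, Matrix.fromBlocks_multiply, Matrix.map_add _ (map_add C),
        Matrix.map_mul, Matrix.map_mul, Matrix.map_mul, Matrix.map_mul]
      simp)
  have hρ : ∀ (c : K) (x : Λ), mapRep (aeval c) ρ x = Matrix.fromBlocks (subRep τ h21 x)
      (c • (τ x).toBlocks₁₂) 0 (quotRep τ h21 x) := by
    intro c x
    change (Matrix.fromBlocks _ _ _ _).map _ = _
    rw [Matrix.fromBlocks_map]
    congr 1 <;> ext i j <;> simp
    exact mul_comm _ _
  have h0 : mapRep (aeval (0 : K)) ρ = sumRep (subRep τ h21) (quotRep τ h21) := by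
    ext1 x
    rw [hρ, zero_smul, sumRep_apply]
  obtain ⟨f, hf, hfc⟩ := hX _ _ ρ (aeval (0 : K)) (by
    rw [h0]
    exact prop_of_linearEquiv (sumRepEquiv _ _).symm (hsum _ _ hα hγ))
  -- The factor `X` forces `c ≠ 0`; a nonzero polynomial has a nonroot since `K` is infinite.
  obtain ⟨c, hc⟩ : ∃ c : K, eval c (f * Polynomial.X) ≠ 0 := by
    by_contra! hcon
    have h1 : f * Polynomial.X = 0 := Polynomial.funext fun c => by rw [hcon, eval_zero]
    rw [mul_eq_zero] at h1
    rcases h1 with h1 | h1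
    · exact hf (by rw [h1, map_zero])
    · exact Polynomial.X_ne_zero h1
  rw [eval_mul, eval_X] at hc
  have hc0 : c ≠ 0 := right_ne_zero_of_mul hc
  have hXc := hfc (aeval c) (by
    rw [Polynomial.coe_aeval_eq_eval]; exact left_ne_zero_of_mul hc)
  let D : Matrix (Fin k ⊕ Fin l) (Fin k ⊕ Fin l) K := Matrix.fromBlocks (c⁻¹ • 1) 0 0 1
  let D' : Matrix (Fin k ⊕ Fin l) (Fin k ⊕ Fin l) K := Matrix.fromBlocks (c • 1) 0 0 1
  have hD : D * D' = 1 := by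
    simp [D, D', Matrix.fromBlocks_multiply, hc0, smul_smul]
  have hD' : D' * D = 1 := by
    simp [D, D', Matrix.fromBlocks_multiply, hc0, smul_smul]
  have hconj : conjRep τ D D' hD hD' = mapRep (aeval c) ρ := by
    ext1 x
    rw [hρ, conjRep_apply]
    conv_lhs => rw [← Matrix.fromBlocks_toBlocks (τ x), h21]
    simp [D, D', Matrix.fromBlocks_multiply, hc0, smul_smul]
  rw [← hconj] at hXc
  exact prop_of_linearEquiv (conjRepEquiv τ D D' hD hD') hXc

end DirectSums

/-! ### Filtered modules as an inductive predicate -/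

section Filtrations

variable {Λ : Type u} [Ring Λ]

/-- The modules with a finite filtration with subquotients in `X`, as an inductive predicate. -/
inductive Filtered (X : ObjectProperty (ModuleCat.{u} Λ)) : ObjectProperty (ModuleCat.{u} Λ)
  | zero (M : ModuleCat.{u} Λ) (h : Subsingleton M) : Filtered X M
  | step (M : ModuleCat.{u} Λ) (U : Submodule Λ M) (hU : Filtered X (ModuleCat.of Λ U))
      (hQ : X (ModuleCat.of Λ (M ⧸ U))) : Filtered X M

variable {X : ObjectProperty (ModuleCat.{u} Λ)}

instance [X.IsClosedUnderIsomorphisms] : (Filtered X).IsClosedUnderIsomorphisms where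
  of_iso {M N} e h := by
    induction h generalizing N with
    | zero M h => exact .zero N (e.toLinearEquiv.symm.injective.subsingleton)
    | step M U hU hQ ih =>
      let f := e.toLinearEquiv
      refine .step N (U.map f.toLinearMap) (ih (f.submoduleMap U).toModuleIso) ?_
      exact prop_of_linearEquiv (Submodule.Quotient.equiv U _ f rfl) hQ

/-- Induction on the filtration of `C`: its last step `V` is pulled back to `M`, with the same
quotient, and the preimage is an extension of `V` by `A`. -/
theorem Filtered.of_exact [X.IsClosedUnderIsomorphisms] {A M C : Type u} [AddCommGroup A]
    [Module Λ A] [AddCommGroup M] [Module Λ M] [AddCommGroup C] [Module Λ C] (i : A →ₗ[Λ] M)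
    (p : M →ₗ[Λ] C) (hi : Function.Injective i) (hp : Function.Surjective p)
    (h : Function.Exact i p) (hA : Filtered X (ModuleCat.of Λ A))
    (hC : Filtered X (ModuleCat.of Λ C)) : Filtered X (ModuleCat.of Λ M) := by
  generalize hC' : ModuleCat.of Λ C = C' at hC
  induction hC generalizing M C with
  | zero C' hs =>
    subst hC'
    have hs : Subsingleton C := hs
    exact prop_of_linearEquiv (LinearEquiv.ofBijective i
      ⟨hi, fun m => (h m).1 (Subsingleton.elim _ _)⟩) hA
  | step C' V hV hQ ih =>
    subst hC'
    let V' : Submodule Λ C := V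
    let W := V'.comap p
    refine .step _ W ?_ ?_
    · let i' : A →ₗ[Λ] W := i.codRestrict W fun a => by
        change p (i a) ∈ V'
        rw [h.apply_apply_eq_zero]; exact zero_mem _
      let p' : W →ₗ[Λ] V' := p.restrict fun w hw => hw
      refine ih (C := V') i' p' (fun a b hab => hi (congrArg Subtype.val hab)) ?_ ?_ rfl
      · rintro ⟨v, hv⟩
        obtain ⟨m, rfl⟩ := hp v
        exact ⟨⟨m, hv⟩, rfl⟩
      · rintro ⟨m, hm⟩
        constructor
        · intro h0
          obtain ⟨a, rfl⟩ := (h m).1 (congrArg Subtype.val h0)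
          exact ⟨a, rfl⟩
        · rintro ⟨a, ha⟩
          have : i a = m := congrArg Subtype.val ha
          refine Subtype.ext ?_
          change p m = 0
          rw [← this, h.apply_apply_eq_zero]
    · have hker : LinearMap.ker (V'.mkQ ∘ₗ p) = W := by
        rw [LinearMap.ker_comp, Submodule.ker_mkQ]
      exact prop_of_linearEquiv ((Submodule.quotEquivOfEq _ _ hker.symm).trans
        ((V'.mkQ ∘ₗ p).quotKerEquivOfSurjective (V'.mkQ_surjective.comp hp))).symm hQ

theorem Filtered.of_prop [X.IsClosedUnderIsomorphisms] {M : ModuleCat.{u} Λ} (h : X M) :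
    Filtered X M :=
  .step M ⊥ (.zero _ (inferInstanceAs (Subsingleton (⊥ : Submodule Λ M))))
    (prop_of_linearEquiv (Submodule.quotEquivOfEqBot ⊥ rfl).symm h)

theorem Filtered.mono {Y : ObjectProperty (ModuleCat.{u} Λ)} (hXY : X ≤ Y) :
    Filtered X ≤ Filtered Y := by
  intro M h
  induction h with
  | zero M h => exact .zero M h
  | step M U hU hQ ih => exact .step M U ih (hXY _ hQ)

theorem Filtered.finite (hX : ∀ M, X M → Module.Finite Λ M) {M : ModuleCat.{u} Λ}
    (h : Filtered X M) : Module.Finite Λ M := by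
  induction h with
  | zero M h => infer_instance
  | step M U hU hQ ih =>
    have := hX _ hQ
    have : Module.Finite Λ U := ih
    exact Module.Finite.of_submodule_quotient U

/-- Dévissage along the filtration, by the long exact sequence for `Ext(B, -)`. -/
theorem Filtered.subsingleton_ext {B : ModuleCat.{u} Λ}
    (hX : ∀ A, X A → Subsingleton (Abelian.Ext.{u} B A 1)) {M : ModuleCat.{u} Λ}
    (h : Filtered X M) : Subsingleton (Abelian.Ext.{u} B M 1) := by
  induction h with
  | zero M h => exact subsingleton_ext_of_subsingleton
  | step M U hU hQ ih =>
    have := hX _ hQ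
    exact subsingleton_ext_of_exact (A := ModuleCat.of Λ U) (M := M)
      (C := ModuleCat.of Λ (M ⧸ U)) U.subtype U.mkQ U.subtype_injective U.mkQ_surjective
      (LinearMap.exact_subtype_mkQ U)

theorem Filtered.pi [X.IsClosedUnderIsomorphisms] {n : ℕ} {A : Fin n → ModuleCat.{u} Λ}
    (h : ∀ i, Filtered X (A i)) : Filtered X (ModuleCat.of Λ (∀ i, A i)) := by
  induction n with
  | zero => exact .zero _ (inferInstanceAs (Subsingleton (∀ i : Fin 0, A i)))
  | succ n ih =>
    let p : (∀ i, A i) →ₗ[Λ] (∀ i : Fin n, A i.succ) :=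
      LinearMap.pi fun i => LinearMap.proj i.succ
    refine Filtered.of_exact (A := A 0) (LinearMap.single Λ (fun i => A i) 0) p
      (fun a b hab => by simpa using congrFun hab 0) (fun v => ⟨Fin.cons 0 v, ?_⟩) (fun v => ?_) (h 0)
      (ih fun i => h i.succ)
    · funext i; rfl
    · constructor
      · intro hv
        refine ⟨v 0, ?_⟩
        funext i
        refine Fin.cases ?_ (fun i => ?_) i
        · simp
        · have := congrFun hv i
          rw [LinearMap.single_apply, Pi.single_eq_of_ne (Fin.succ_ne_zero i)]
          exact this.symm
      · rintro ⟨a, rfl⟩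
        funext i
        simp [p]

theorem prop_subquotient_congr {M : ModuleCat.{u} Λ} {A A' B B' : Submodule Λ M} (hA : A' = A)
    (hB : B' = B) (h : X (ModuleCat.of Λ (B ⧸ A.submoduleOf B))) :
    X (ModuleCat.of Λ (B' ⧸ A'.submoduleOf B')) := by
  subst hA hB; exact h

theorem filt_eq_filtered [X.IsClosedUnderIsomorphisms] : Filt X = Filtered X := by
  refine le_antisymm ?_ ?_
  · rintro M ⟨n, F, hmono, h0, h1, hX⟩
    have key : ∀ k, Filtered X (ModuleCat.of Λ (F k)) := by
      intro k
      induction k using Fin.induction with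
      | zero =>
        rw [h0]
        exact .zero _ (inferInstanceAs (Subsingleton (⊥ : Submodule Λ M)))
      | succ k ih =>
        refine .step _ ((F k.castSucc).submoduleOf (F k.succ)) ?_ (hX k)
        exact prop_of_linearEquiv
          (Submodule.submoduleOfEquivOfLe (hmono k.castSucc_le_succ)).symm ih
    have := key (Fin.last n)
    rw [h1] at this
    exact prop_of_linearEquiv (N := M) Submodule.topEquiv this
  · intro M h
    induction h with
    | zero M h =>
      refine ⟨0, fun _ => ⊥, fun _ _ _ => le_rfl, rfl, ?_, fun i => i.elim0⟩
      exact Subsingleton.elim _ _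
    | step M U hU hQ ih =>
      obtain ⟨n, F, hmono, h0, h1, hX⟩ := ih
      have h1' : (F (Fin.last n)).map U.subtype = U := by
        rw [h1]; simp
      have hle : ∀ k, (F k).map U.subtype ≤ U := fun k => by
        rintro _ ⟨x, _, rfl⟩; exact x.2
      -- The chain of `U` is pushed into `M`, where it ends at `U`, and the whole module is
      -- appended.
      refine ⟨n + 1, Fin.snoc (fun k => (F k).map U.subtype) ⊤, ?_, ?_, ?_, ?_⟩
      · rw [Fin.monotone_iff_le_succ]
        intro i
        refine Fin.lastCases ?_ (fun i => ?_) i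
        · rw [Fin.succ_last, Fin.snoc_last]
          exact le_top
        · rw [Fin.succ_castSucc, Fin.snoc_castSucc, Fin.snoc_castSucc]
          exact Submodule.map_mono (hmono i.castSucc_le_succ)
      · rw [← Fin.castSucc_zero, Fin.snoc_castSucc, h0, Submodule.map_bot]
      · simp
      · intro i
        refine Fin.lastCases ?_ (fun i => ?_) i
        · refine prop_subquotient_congr (A := U) (B := ⊤) (by rw [Fin.snoc_castSucc, h1'])
            (by rw [Fin.succ_last, Fin.snoc_last]) ?_
          refine prop_of_linearEquiv (Submodule.Quotient.equiv _ _ Submodule.topEquiv ?_).symm hQ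
          ext x
          simp [Submodule.submoduleOf]
        · refine prop_subquotient_congr (A := (F i.castSucc).map U.subtype)
            (B := (F i.succ).map U.subtype) (by rw [Fin.snoc_castSucc])
            (by rw [Fin.succ_castSucc, Fin.snoc_castSucc]) ?_
          refine prop_of_linearEquiv
            (Submodule.Quotient.equiv _ _ (Submodule.equivSubtypeMap U (F i.succ)) ?_) (hX i)
          ext ⟨x, hx⟩
          obtain ⟨y, hy, rfl⟩ := hx
          simp only [Submodule.submoduleOf, Submodule.mem_map, Submodule.mem_comap]
          constructor
          · rintro ⟨z, hz, hzy⟩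
            have hzy' := congrArg Subtype.val hzy
            exact ⟨z, hz, hzy'⟩
          · rintro ⟨z, hz, hzy⟩
            exact ⟨⟨z, hmono i.castSucc_le_succ hz⟩, hz, Subtype.ext hzy⟩

end Filtrations

end BoundQuiver

namespace BoundQuiver

open CategoryTheory

/-! ### Rearranging filtrations -/

section Rearrangement

variable {Λ : Type u} [Ring Λ] {A Y : ObjectProperty (ModuleCat.{u} Λ)}

/-- The preimage `W` of the complement `s(D)` is an extension of `D` by the kernel of `π`, so it
lies in `A`; the quotient of `M` by `W` is `N / s(D) ≅ C`. -/
theorem extensionProperty_of_split [A.IsClosedUnderIsomorphisms] [Y.IsClosedUnderIsomorphisms]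
    (hext : ExtensionProperty A A ≤ A) {M N C D : Type u} [AddCommGroup M]
    [Module Λ M] [AddCommGroup N] [Module Λ N] [AddCommGroup C] [Module Λ C] [AddCommGroup D]
    [Module Λ D] (π : M →ₗ[Λ] N) (hπ : Function.Surjective π) (i : C →ₗ[Λ] N) (p : N →ₗ[Λ] D)
    (hi : Function.Injective i) (h : Function.Exact i p) (s : D →ₗ[Λ] N)
    (hs : p ∘ₗ s = LinearMap.id) (hA : A (ModuleCat.of Λ (LinearMap.ker π)))
    (hD : A (ModuleCat.of Λ D)) (hC : Y (ModuleCat.of Λ C)) :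
    ExtensionProperty A Y (ModuleCat.of Λ M) := by
  have hps : ∀ x, p (s x) = x := fun x => LinearMap.congr_fun hs x
  have hsi : Function.Injective s := fun x y hxy => by rw [← hps x, hxy, hps]
  let V := LinearMap.range s
  let W := V.comap π
  refine ⟨W, ?_, ?_⟩
  · refine hext _ ?_
    let ι : LinearMap.ker π →ₗ[Λ] W := Submodule.inclusion fun x hx => by
      change π x ∈ V
      rw [LinearMap.mem_ker.1 hx]; exact zero_mem _
    let ρ : W →ₗ[Λ] V := π.restrict fun w hw => hw
    refine extensionProperty_of_exact ι ρ (Submodule.inclusion_injective _) ?_ ?_ hA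
      (prop_of_linearEquiv (LinearEquiv.ofInjective s hsi) hD)
    · rintro ⟨v, hv⟩
      obtain ⟨m, rfl⟩ := hπ v
      exact ⟨⟨m, hv⟩, rfl⟩
    · rintro ⟨m, hm⟩
      constructor
      · intro h0
        exact ⟨⟨m, congrArg Subtype.val h0⟩, rfl⟩
      · rintro ⟨⟨a, ha⟩, hx⟩
        have : a = m := congrArg Subtype.val hx
        subst this
        exact Subtype.ext ha
  · have hker : LinearMap.ker (V.mkQ ∘ₗ π) = W := by
      rw [LinearMap.ker_comp, Submodule.ker_mkQ]
    have hbij : Function.Bijective (V.mkQ ∘ₗ i) := by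
      constructor
      · rw [← LinearMap.ker_eq_bot, LinearMap.ker_eq_bot']
        intro c hc
        obtain ⟨x, hx⟩ : i c ∈ V := (Submodule.Quotient.mk_eq_zero V).1 hc
        have hx0 : x = 0 := by rw [← hps x, hx, h.apply_apply_eq_zero]
        rw [hx0, map_zero] at hx
        exact hi (by rw [← hx, map_zero])
      · intro y
        obtain ⟨n, rfl⟩ := V.mkQ_surjective y
        obtain ⟨c, hc⟩ := (h (n - s (p n))).1 (by rw [map_sub, hps, sub_self])
        refine ⟨c, ?_⟩
        rw [LinearMap.comp_apply, hc, map_sub, sub_eq_self]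
        exact (Submodule.Quotient.mk_eq_zero V).2 ⟨_, rfl⟩
    exact prop_of_linearEquiv ((LinearEquiv.ofBijective _ hbij).trans
      ((Submodule.quotEquivOfEq _ _ hker.symm).trans
        ((V.mkQ ∘ₗ π).quotKerEquivOfSurjective (V.mkQ_surjective.comp hπ))).symm) hC

/-- Filtrations with subquotients in `A` or in `Y` can be rearranged such that the subquotients in
`A` come first, if `A` is closed under extensions and `Ext¹(A, Y) = 0`. -/
theorem filtered_or_eq [A.IsClosedUnderIsomorphisms] [Y.IsClosedUnderIsomorphisms]
    (hzero : ∀ M : ModuleCat.{u} Λ, Subsingleton M → A M) (hext : ExtensionProperty A A ≤ A)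
    (hExt : ∀ B C : ModuleCat.{u} Λ, A B → Y C → Subsingleton (Abelian.Ext.{u} B C 1)) :
    Filtered (fun M => A M ∨ Y M) = ExtensionProperty A (Filtered Y) := by
  have : ObjectProperty.IsClosedUnderIsomorphisms (fun M : ModuleCat.{u} Λ => A M ∨ Y M) :=
    ⟨fun e h => h.imp (A.prop_of_iso e) (Y.prop_of_iso e)⟩
  refine le_antisymm ?_ ?_
  · intro M h
    induction h with
    | zero M h =>
      exact ⟨⊥, hzero _ (inferInstanceAs (Subsingleton (⊥ : Submodule Λ M))),
        .zero _ (inferInstanceAs (Subsingleton (M ⧸ (⊥ : Submodule Λ M))))⟩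
    | step M U hU hQ ih =>
      obtain ⟨U', hA, hY⟩ := ih
      let U' : Submodule Λ U := U'
      have hY' : Filtered Y (ModuleCat.of Λ (U ⧸ U')) := hY
      -- With `V` the part of `U` in `A`, the sequence `0 → U/U' → M/V → M/U → 0` compares the new
      -- top factor with the `Y`-filtered part.
      let V : Submodule Λ M := U'.map U.subtype
      have hVU : V ≤ U := by rintro _ ⟨x, _, rfl⟩; exact x.2
      have hAV : A (ModuleCat.of Λ V) := prop_of_linearEquiv (Submodule.equivSubtypeMap U U') hA
      let i : (U ⧸ U') →ₗ[Λ] (M ⧸ V) := U'.mapQ V U.subtype (fun x hx => ⟨x, hx, rfl⟩)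
      let p : (M ⧸ V) →ₗ[Λ] (M ⧸ U) := Submodule.factor hVU
      have hi : Function.Injective i := by
        rw [← LinearMap.ker_eq_bot, LinearMap.ker_eq_bot']
        intro x hx
        obtain ⟨x, rfl⟩ := U'.mkQ_surjective x
        obtain ⟨y, hy, hyx⟩ := (Submodule.Quotient.mk_eq_zero V).1 hx
        have : y = x := Subtype.ext hyx
        subst this
        exact (Submodule.Quotient.mk_eq_zero U').2 hy
      have hp : Function.Surjective p := Submodule.factor_surjective hVU
      have hex : Function.Exact i p := by
        intro x
        obtain ⟨x, rfl⟩ := V.mkQ_surjective x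
        constructor
        · intro hx
          exact ⟨U'.mkQ ⟨x, (Submodule.Quotient.mk_eq_zero U).1 hx⟩, rfl⟩
        · rintro ⟨y, hy⟩
          obtain ⟨y, rfl⟩ := U'.mkQ_surjective y
          rw [← hy]
          exact (Submodule.Quotient.mk_eq_zero U).2 y.2
      rcases hQ with hQ | hQ
      -- A top factor in `A` splits off from `M/V` and is absorbed into the submodule; a top factor
      -- in `Y` just prolongs the filtration of `U/U'`.
      · have : Subsingleton (Abelian.Ext.{u} (ModuleCat.of Λ (M ⧸ U))
            (ModuleCat.of Λ (U ⧸ U')) 1) :=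
          Filtered.subsingleton_ext (fun C hC => hExt _ C hQ hC) hY'
        obtain ⟨s, hs⟩ := exists_section_of_subsingleton_ext (A := ModuleCat.of Λ (U ⧸ U'))
          (M := ModuleCat.of Λ (M ⧸ V)) (C := ModuleCat.of Λ (M ⧸ U)) i p hi hp hex
        refine extensionProperty_of_split (M := M) hext V.mkQ V.mkQ_surjective i p hi hex s hs
          ?_ hQ hY'
        rw [Submodule.ker_mkQ]
        exact hAV
      · exact ⟨V, hAV, Filtered.of_exact i p hi hp hex hY' (Filtered.of_prop hQ)⟩
  · rintro M ⟨U, hU, hQ⟩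
    exact Filtered.of_exact (M := M) U.subtype U.mkQ U.subtype_injective U.mkQ_surjective
      (LinearMap.exact_subtype_mkQ U) (Filtered.of_prop (Or.inl hU))
      (Filtered.mono (fun _ h => Or.inr h) _ hQ)

end Rearrangement

/-! ### Additive closures -/

section AdditiveClosure

variable {Λ : Type u} [Ring Λ] {X : ObjectProperty (ModuleCat.{u} Λ)}

theorem IsAdditivelyClosed.prod (hX : IsAdditivelyClosed X) (A B : ModuleCat.{u} Λ) (hA : X A)
    (hB : X B) : X (ModuleCat.of Λ (A × B)) := by
  refine hX.addClosure_le _ ⟨2, ![A, B], ModuleCat.of Λ PUnit, ?_, ⟨?_⟩⟩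
  · intro i
    fin_cases i
    · exact hA
    · exact hB
  · exact LinearEquiv.prodUnique.trans
      (LinearEquiv.piFinTwo Λ fun i => (![A, B] : Fin 2 → ModuleCat.{u} Λ) i).symm

theorem IsAdditivelyClosed.zero (hX : IsAdditivelyClosed X) (M : ModuleCat.{u} Λ)
    (h : Subsingleton M) : X M :=
  hX.addClosure_le _ ⟨0, fun i => i.elim0, ModuleCat.of Λ PUnit, fun i => i.elim0,
    ⟨{ toFun := fun _ i => i.elim0
       invFun := fun _ => 0
       left_inv := fun _ => Subsingleton.elim (α := M × PUnit) _ _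
       right_inv := fun _ => funext fun i => i.elim0
       map_add' := fun _ _ => funext fun i => i.elim0
       map_smul' := fun _ _ => funext fun i => i.elim0 }⟩⟩

theorem IsAdditivelyClosed.isClosedUnderIsomorphisms (hX : IsAdditivelyClosed X) :
    X.IsClosedUnderIsomorphisms where
  of_iso {M _} e h := hX.addClosure_le _ ⟨1, fun _ => M, ModuleCat.of Λ PUnit, fun _ => h,
    ⟨LinearEquiv.prodUnique.trans
      (e.toLinearEquiv.symm.trans (LinearEquiv.funUnique (Fin 1) Λ M).symm)⟩⟩

/-- A finite direct sum of filtered modules is filtered, so one filtered module with summand `M` is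
enough. -/
theorem addClosure_filtered_eq [X.IsClosedUnderIsomorphisms] :
    addClosure (Filtered X) = fun M : ModuleCat.{u} Λ => ∃ N : ModuleCat.{u} Λ,
      Filtered X (ModuleCat.of Λ (M × N)) := by
  refine le_antisymm ?_ ?_
  · rintro M ⟨n, A, N, hA, ⟨e⟩⟩
    exact ⟨N, prop_of_linearEquiv e.symm (Filtered.pi hA)⟩
  · rintro M ⟨N, hN⟩
    exact ⟨1, fun _ => ModuleCat.of Λ (M × N), N, fun _ => hN,
      ⟨(LinearEquiv.funUnique (Fin 1) Λ (M × N)).symm⟩⟩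

theorem isAdditivelyClosed_addClosure_filtered [X.IsClosedUnderIsomorphisms]
    (hX : ∀ M, X M → Module.Finite Λ M) : IsAdditivelyClosed (addClosure (Filtered X)) := by
  rw [addClosure_filtered_eq]
  refine ⟨?_, ?_⟩
  · rintro M ⟨N, hN⟩
    have : Module.Finite Λ (M × N) := Filtered.finite hX hN
    exact Module.Finite.of_surjective (LinearMap.fst Λ M N) LinearMap.fst_surjective
  · rintro M ⟨n, A, N, hA, ⟨e⟩⟩
    choose B hB using hA
    let f : (∀ i, A i × B i) ≃ₗ[Λ] (∀ i, A i) × (∀ i, B i) :=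
      { toFun := fun v => (fun i => (v i).1, fun i => (v i).2)
        invFun := fun w i => (w.1 i, w.2 i)
        left_inv := fun _ => rfl
        right_inv := fun _ => rfl
        map_add' := fun _ _ => rfl
        map_smul' := fun _ _ => rfl }
    -- The complements of the summands `A i` are collected into the complement of `M`.
    exact ⟨ModuleCat.of Λ (N × (∀ i, B i)), prop_of_linearEquiv
      (f.trans ((e.symm.prodCongr (LinearEquiv.refl Λ _)).trans (LinearEquiv.prodAssoc Λ _ _ _)))
      (Filtered.pi (A := fun i => ModuleCat.of Λ (A i × B i)) hB)⟩

end AdditiveClosure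

/-! ### Induction on the number of classes -/

section Main

variable {K : Type u} [Field K] {Λ : Type u} [Ring Λ] [Algebra K Λ]

/-- Only the zero module is filtered by nothing, and all fibres of a family have the same dimension.
-/
theorem locallyOpen_filtered_false :
    LocallyOpen K (Filtered fun _ : ModuleCat.{u} Λ => False) := by
  intro n _ _ B _ _ σ b₀ h
  have hs : Subsingleton (RepSpace (mapRep b₀ σ)) := by
    cases h with
    | zero _ h => exact h
    | step _ U _ hQ => exact hQ.elim
  have hs' : Subsingleton (n → K) := hs
  have : IsEmpty n := by
    by_contra hn
    rw [not_isEmpty_iff] at hn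
    exact not_subsingleton (n → K) hs'
  refine ⟨1, by rw [map_one]; exact one_ne_zero, fun b _ => .zero _ ?_⟩
  exact inferInstanceAs (Subsingleton (n → K))

/-- Induction from the last class: `Ext¹` from it to all earlier classes vanishes, so its factors go
to the bottom, and the same vanishing, extended to modules filtered by the earlier classes, is what
the openness of extensions requires. -/
theorem locallyOpen_filtered [IsAlgClosed K] [FiniteDimensional K Λ] (r : ℕ)
    (X : Fin r → ObjectProperty (ModuleCat.{u} Λ)) (hadd : ∀ i, IsAdditivelyClosed (X i))
    (hopen : ∀ i, LocallyOpen K (X i))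
    (hExt : ∀ i j : Fin r, i < j → ∀ A B : ModuleCat.{u} Λ, X i A → X j B →
      Subsingleton (Abelian.Ext.{u} B A 1)) :
    LocallyOpen K (Filtered fun M => ∃ i, X i M) := by
  induction r with
  | zero =>
    have : (fun M : ModuleCat.{u} Λ => ∃ i, X i M) = fun _ => False := by
      funext M; simp
    rw [this]
    exact locallyOpen_filtered_false
  | succ r ih =>
    have hiso := fun i => (hadd i).isClosedUnderIsomorphisms
    have : Infinite K := IsAlgClosed.instInfinite
    let Y : ObjectProperty (ModuleCat.{u} Λ) := fun M => ∃ i : Fin r, X i.castSucc M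
    have : Y.IsClosedUnderIsomorphisms :=
      ⟨fun e ⟨i, h⟩ => ⟨i, (X i.castSucc).prop_of_iso e h⟩⟩
    have hY : LocallyOpen K (Filtered Y) := ih (fun i => X i.castSucc) (fun i => hadd _)
      (fun i => hopen _) (fun i j hij => hExt _ _ hij)
    have hExtY : ∀ B C : ModuleCat.{u} Λ, X (Fin.last r) B → Y C →
        Subsingleton (Abelian.Ext.{u} B C 1) := fun B C hB ⟨i, hC⟩ =>
      hExt i.castSucc (Fin.last r) (Fin.castSucc_lt_last i) C B hC hB
    have hor : (fun M : ModuleCat.{u} Λ => ∃ i, X i M) =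
        fun M => X (Fin.last r) M ∨ Y M := by
      funext M
      refine propext ⟨?_, ?_⟩
      · rintro ⟨i, h⟩
        induction i using Fin.lastCases with
        | last => exact Or.inl h
        | cast i => exact Or.inr ⟨i, h⟩
      · rintro (h | ⟨i, h⟩)
        · exact ⟨_, h⟩
        · exact ⟨_, h⟩
    rw [hor, filtered_or_eq (hadd _).zero ((hopen _).extensionProperty_le (hadd _).finite
      (hadd _).prod) hExtY]
    exact (hopen _).extensionProperty hY
      (fun B C hB hC => Filtered.subsingleton_ext (fun A hA => hExtY B A hB hA) hC)

end Main

end BoundQuiver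

theorem proposition2 {K : Type u} [Field K] [IsAlgClosed K]
    {Q : Type} [Quiver.{0} Q] [Fintype Q] [DecidableEq Q] [∀ i j : Q, Finite (i ⟶ j)]
    {Λ : Type u} [Ring Λ] [Algebra K Λ] [FiniteDimensional K Λ]
    (P : BoundQuiver.Presentation K Q Λ)
    (r : ℕ) (X : Fin r → CategoryTheory.ObjectProperty (ModuleCat.{u} Λ))
    (hX : ∀ i, BoundQuiver.IsOpenSubcategory P (X i))
    (hExt : ∀ i j : Fin r, i < j → ∀ A B : ModuleCat.{u} Λ, X i A → X j B →
      Subsingleton (CategoryTheory.Abelian.Ext.{u} B A 1)) :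
    BoundQuiver.IsOpenSubcategory P
      (BoundQuiver.addClosure (BoundQuiver.Filt (fun M => ∃ i, X i M))) := by
  have hiso := fun i => (hX i).isAdditivelyClosed.isClosedUnderIsomorphisms
  have hfin : ∀ M : ModuleCat.{u} Λ, (∃ i, X i M) → Module.Finite Λ M :=
    fun M ⟨i, h⟩ => (hX i).isAdditivelyClosed.finite M h
  have : CategoryTheory.ObjectProperty.IsClosedUnderIsomorphisms
      (fun M : ModuleCat.{u} Λ => ∃ i, X i M) :=
    ⟨fun e ⟨i, h⟩ => ⟨i, (X i).prop_of_iso e h⟩⟩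
  have hopen := (BoundQuiver.locallyOpen_filtered r X (fun i => (hX i).isAdditivelyClosed)
    (fun i => BoundQuiver.locallyOpen_of_isZariskiOpenIn P (hX i).isOpen) hExt).of_prod
    (fun M hM => BoundQuiver.Filtered.finite hfin hM)
  rw [BoundQuiver.filt_eq_filtered]
  have hadd := BoundQuiver.isAdditivelyClosed_addClosure_filtered hfin
  have := hadd.isClosedUnderIsomorphisms
  rw [← BoundQuiver.addClosure_filtered_eq] at hopen
  exact ⟨hadd, hopen.isZariskiOpenIn P⟩
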